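/- Let $n$ be even. A roommates instance with member set $[n]$ assigns to every member $i$ a ranking $R_i$, a bijection $[n]\to[n]$ with $R_i(i)=n$ ($R_i(j)=k$ means that $j$ is the $k$-th best choice of $i$). A permutation $\Pi$ of $[n]$ is a stable partition of the instance if (1) $R_i(\Pi(i))\le R_i(\Pi^{-1}(i))$ for every $i$, and (2) for all $i\ne j$ with $j\ne\Pi(i)$ and $i\ne\Pi(j)$, $R_i(j)<R_i(\Pi^{-1}(i))$ implies $R_j(i)>R_j(\Pi^{-1}(j))$. Put $\mathcal R(\Pi)=\sum_{i\in[n]}R_i(\Pi^{-1}(i))$ (total rank of the predecessors) and $R_{\max}(\Pi)=\max_{i\in[n]}R_i(\Pi^{-1}(i))$ (worst rank of a predecessor). Let $I_n$ be uniformly random among all $[(n-1)!]^n$ instances, and let probabilities refer to $I_n$. **Theorem.** For every $\varepsilon\in(0,1)$ there are $c=c(\varepsilon)>0$ and $N=N(\varepsilon)$ such that for all even $n\ge N$ $$\mathrm P\left(\text{some stable partition }\Pi\text{ without a fixed point satisfies }\left|\frac{\mathcal R(\Pi)}{n^{3/2}}-1\right|\ge\varepsilon\right)\le e^{-c\log^2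 n}.$$ Consequently, for every $\varepsilon\in(0,1)$ there are $c>0$ and $N$ such that for all even $n\ge N$, with probability at least $1-e^{-c\log^2 n}$, every stable partition $\Pi$ satisfies $R_{\max}(\Pi)\ge(1-\varepsilon)n^{1/2}$. In particular, there is a sequence $\delta_n\to0$ such that, with probability tending to $1$ as $n\to\infty$ through the even integers, every stable partition $\Pi$ satisfies $R_{\max}(\Pi)\ge(1-\delta_n)n^{1/2}$. -/

import Mathlib

open Filter Topology

/-- A roommates instance with members `0, …, n - 1`: `pref i` is the preference list `σ_i` of
member `i`, where `pref i k` is the member in position `k + 1`. Each member occupies the last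
position of their own list. -/
structure Roommates (n : ℕ) where
  pref : Fin n → Equiv.Perm (Fin n)
  self_last : ∀ i, ((pref i).symm i : ℕ) + 1 = n

namespace Roommates

variable {n : ℕ}

/-- `R_i(j)`, a number from `1` (best) to `n` (worst): the position of `j` in the list of `i`. -/
def rank (I : Roommates n) (i j : Fin n) : ℕ := ((I.pref i).symm j : ℕ) + 1

/-- Stable (cyclic) partitions, in the sense of Tan. `P i` is the successor of `i` and `P.symm i`
its predecessor. (1) Nobody prefers their predecessor to their successor. (2) No two distinct
members, neither of whom is the successor of the other, prefer each other to their
predecessors. -/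
def IsStable (I : Roommates n) (P : Equiv.Perm (Fin n)) : Prop :=
  (∀ i, I.rank i (P i) ≤ I.rank i (P.symm i)) ∧
  (∀ i j, i ≠ j → j ≠ P i → i ≠ P j →
    I.rank i j < I.rank i (P.symm i) → I.rank j (P.symm j) < I.rank j i)

/-- The sum of the ranks of all predecessors in the lists of their successors. -/
def totalRank (I : Roommates n) (P : Equiv.Perm (Fin n)) : ℕ :=
  ∑ i, I.rank i (P.symm i)

/-- The largest (worst) rank of a predecessor. -/
def worstRank (I : Roommates n) (P : Equiv.Perm (Fin n)) : ℕ :=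
  Finset.univ.sup fun i => I.rank i (P.symm i)

theorem pref_injective : Function.Injective (pref : Roommates n → _) := by
  rintro ⟨a, _⟩ ⟨b, _⟩ h
  cases h
  rfl

noncomputable instance : Fintype (Roommates n) :=
  Fintype.ofInjective pref pref_injective

instance : Nonempty (Roommates n) :=
  ⟨{ pref := fun i => Equiv.swap i ⟨n - 1, by have := i.isLt; omega⟩
     self_last := fun i => by
      have := i.isLt
      simp only [Equiv.symm_swap, Equiv.swap_apply_left]
      omega }⟩

/-- Every set of instances is an event. -/
instance : MeasurableSpace (Roommates n) := ⊤

/-- The probability of an event for the uniformly random instance `I_n`. -/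
noncomputable def prob (n : ℕ) (A : Set (Roommates n)) : ℝ :=
  (ProbabilityTheory.uniformOn (Set.univ : Set (Roommates n))).real A

end Roommates

/-! The proof is a first moment bound with exponential tilting. For a permutation `P` without fixed
points let `A i` be the set of members whom `i` prefers to the predecessor, so that the total rank
is `n + ∑ |A i|`. A given family `A` occurs with probability at most `∏ |A i|! (n-2-|A i|)! /
(n-1)!`. By the Beta integral this equals `∏ ∫ x^|A i| (1-x)^(n-2-|A i|) dx`, as if `i` preferred
each other member independently with probability `x i`.

Stability forbids mutual preference in pairs that are not adjacent in `P`. For fixed `x`, the sum of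
`z^(∑ |A i|)` over the admissible families is therefore bounded by a product over pairs
(`sum_admissible_le`), at most about `exp((z-1) n s - (2z-1) s²/2)` with `s = ∑ x i`. Replacing `s²`
by its tangent at `s = √n` separates the variables. Each member then contributes `1/b` with `b ≈
√n`, and each member outside the 2-cycles a further `z/b` (`sum_stable_le_of_exponent`).

Summed over `P`, the number of perfect matchings, of order `(n/e)^(n/2)` up to polynomial factors,
cancels `e^(n/2) n^(-n/2)`, and the longer cycles cost little (`sum_pow_longCard_le_exp`). With `z =
exp(θ/√n)` the expected weighted count is at most `exp(θ n + 58 θ² n + O(√n))` (`stableMoment_le`).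
As `z^(n^(3/2)) = exp(θ n)`, Markov's inequality with small `θ` of either sign bounds the deviation
probability by `exp(-c n)` for large `n`, more than is needed.

The worst rank is at least the average rank, and a fixed point has itself as predecessor, with rank
`n`. -/

namespace Roommates

variable {n : ℕ}

/-! ### Preference sets and the counting of lists -/

/-- The members whom `i` prefers to `p`. -/
def better (I : Roommates n) (i p : Fin n) : Finset (Fin n) :=
  Finset.univ.filter fun j => I.rank i j < I.rank i p

theorem mem_better {I : Roommates n} {i p j : Fin n} :
    j ∈ I.better i p ↔ I.rank i j < I.rank i p := by simp [better]

theorem rank_lt_iff {I : Roommates n} {i p j : Fin n} :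
    I.rank i j < I.rank i p ↔ (I.pref i).symm j < (I.pref i).symm p := by
  simp [rank]

theorem rank_self (I : Roommates n) (i : Fin n) : I.rank i i = n := I.self_last i

theorem rank_le (I : Roommates n) (i j : Fin n) : I.rank i j ≤ n := by
  have := ((I.pref i).symm j).isLt
  simp only [rank]; omega

theorem rank_injective (I : Roommates n) (i : Fin n) : Function.Injective (I.rank i) := by
  intro a b h
  have : (I.pref i).symm a = (I.pref i).symm b := by
    apply Fin.ext; simpa [rank] using h
  exact (I.pref i).symm.injective this

theorem card_symm_lt (σ : Equiv.Perm (Fin n)) (p : Fin n) :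
    (Finset.univ.filter fun j => σ.symm j < σ.symm p).card = (σ.symm p : ℕ) := by
  rw [← Fin.card_Iio (σ.symm p), ← Finset.card_map σ.symm.toEmbedding]
  congr 1
  ext k
  simp only [Finset.mem_map, Finset.mem_filter, Finset.mem_univ, true_and, Finset.mem_Iio,
    Equiv.toEmbedding_apply]
  constructor
  · rintro ⟨j, h, rfl⟩; exact h
  · intro h; exact ⟨σ k, by simpa using h, by simp⟩

theorem rank_eq_card_better (I : Roommates n) (i p : Fin n) :
    I.rank i p = (I.better i p).card + 1 := by
  rw [rank, ← card_symm_lt]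
  simp only [better, rank_lt_iff]

/-- The lists of `i` in which exactly the members of `A` precede `p`. -/
abbrev ListsWith (i p : Fin n) (A : Finset (Fin n)) : Type :=
  {σ : Equiv.Perm (Fin n) // (σ.symm i : ℕ) + 1 = n ∧ ∀ j, j ∈ A ↔ σ.symm j < σ.symm p}

theorem ListsWith.pos_eq {i p : Fin n} {A : Finset (Fin n)} (σ : ListsWith i p A) :
    (σ.1.symm p : ℕ) = A.card := by
  rw [← card_symm_lt]
  congr 1
  ext j
  simp [σ.2.2 j]

/-- Such a list is an arrangement of `A`, then `p`, then an arrangement of the other `n - 2 -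
A.card` members, then `i`. -/
theorem card_listsWith_le {i p : Fin n} (hip : i ≠ p) (A : Finset (Fin n)) :
    Fintype.card (ListsWith i p A) ≤ A.card.factorial * (n - 2 - A.card).factorial := by
  set B : Finset (Fin n) := Finset.univ.filter fun j => j ∉ A ∧ j ≠ i ∧ j ≠ p with hB
  have hlt : ∀ (σ : ListsWith i p A) (j : Fin n), j ∈ A → (σ.1.symm j : ℕ) < A.card := by
    intro σ j hj
    have := (σ.2.2 j).1 hj
    rw [Fin.lt_def, σ.pos_eq] at this
    exact this
  have hgt : ∀ (σ : ListsWith i p A) (j : Fin n), j ∈ B →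
      A.card < (σ.1.symm j : ℕ) ∧ (σ.1.symm j : ℕ) + 1 < n := by
    intro σ j hj
    simp only [hB, Finset.mem_filter, Finset.mem_univ, true_and] at hj
    have h1 : ¬ σ.1.symm j < σ.1.symm p := fun h => hj.1 ((σ.2.2 j).2 h)
    have h2 : (σ.1.symm j : ℕ) ≠ σ.1.symm p := fun h => hj.2.2 (σ.1.symm.injective (Fin.ext h))
    have h3 : (σ.1.symm j : ℕ) ≠ σ.1.symm i := fun h => hj.2.1 (σ.1.symm.injective (Fin.ext h))
    have h4 := σ.2.1
    have h5 := σ.pos_eq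
    have h6 := (σ.1.symm j).isLt
    rw [Fin.lt_def] at h1
    omega
  -- An actual list is needed to know that `i` and `p` lie outside `A`, which determines the size of
  -- `B`.
  rcases isEmpty_or_nonempty (ListsWith i p A) with he | ⟨⟨σ₀⟩⟩
  · rw [Fintype.card_eq_zero]; exact Nat.zero_le _
  have hBcard : B.card = n - 2 - A.card := by
    have hi : i ∉ A := by
      intro h
      have := (σ₀.2.2 i).1 h
      rw [Fin.lt_def] at this
      have h2 := σ₀.2.1
      have h3 := (σ₀.1.symm p).isLt
      omega
    have hp : p ∉ A := fun h => lt_irrefl _ ((σ₀.2.2 p).1 h)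
    have : B = (insert i (insert p A))ᶜ := by
      ext j
      simp only [hB, Finset.mem_filter, Finset.mem_univ, true_and, Finset.mem_compl,
        Finset.mem_insert, not_or]
      tauto
    rw [this, Finset.card_compl, Finset.card_insert_of_notMem (by simp [hip, hi]),
      Finset.card_insert_of_notMem hp, Fintype.card_fin]
    omega
  let f : ListsWith i p A → (A ↪ Fin A.card) × (B ↪ Fin (n - 2 - A.card)) := fun σ =>
    (⟨fun j => ⟨σ.1.symm j, hlt σ j j.2⟩, fun a b h => by
        simp only [Fin.mk.injEq] at h
        exact Subtype.ext (σ.1.symm.injective (Fin.ext h))⟩,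
     ⟨fun j => ⟨(σ.1.symm j : ℕ) - A.card - 1, by have := hgt σ j j.2; omega⟩, fun a b h => by
        simp only [Fin.mk.injEq] at h
        have h1 := hgt σ a a.2
        have h2 := hgt σ b b.2
        exact Subtype.ext (σ.1.symm.injective (Fin.ext (by omega)))⟩)
  have hf : Function.Injective f := by
    intro σ τ h
    simp only [f, Prod.mk.injEq] at h
    obtain ⟨h1, h2⟩ := h
    have key : ∀ j, σ.1.symm j = τ.1.symm j := by
      intro j
      apply Fin.ext
      by_cases hA : j ∈ A
      · have h3 : (⟨σ.1.symm j, hlt σ j hA⟩ : Fin A.card) = ⟨τ.1.symm j, hlt τ j hA⟩ :=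
          DFunLike.congr_fun h1 ⟨j, hA⟩
        simpa using h3
      by_cases hji : j = i
      · subst hji
        have := σ.2.1
        have := τ.2.1
        omega
      by_cases hjp : j = p
      · subst hjp
        rw [σ.pos_eq, τ.pos_eq]
      have hjB : j ∈ B := by simp [hB, hA, hji, hjp]
      have h3 : (σ.1.symm j : ℕ) - A.card - 1 = (τ.1.symm j : ℕ) - A.card - 1 :=
        congrArg (fun k : Fin (n - 2 - A.card) => (k : ℕ)) (DFunLike.congr_fun h2 ⟨j, hjB⟩)
      have h1 := hgt σ j hjB
      have h2 := hgt τ j hjB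
      omega
    apply Subtype.ext
    have : σ.1.symm = τ.1.symm := Equiv.ext key
    simpa using congrArg Equiv.symm this
  refine (Fintype.card_le_of_injective f hf).trans (le_of_eq ?_)
  rw [Fintype.card_prod, Fintype.card_embedding_eq, Fintype.card_embedding_eq, Fintype.card_coe,
    Fintype.card_coe, Fintype.card_fin, Fintype.card_fin, hBcard, Nat.descFactorial_self,
    Nat.descFactorial_self]

/-- The lists in which `i` comes last. -/
abbrev Lists (i : Fin n) : Type := {σ : Equiv.Perm (Fin n) // (σ.symm i : ℕ) + 1 = n}

/-- Composing with the transposition of `i` and the last position gives the permutations that fix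
`i`. -/
theorem card_lists (i : Fin n) : Fintype.card (Lists i) = (n - 1).factorial := by
  have hn : n - 1 < n := by have := i.isLt; omega
  let l : Fin n := ⟨n - 1, hn⟩
  let e : Lists i ≃ {f : Equiv.Perm (Fin n) // ∀ a, ¬ (a ≠ i) → f a = a} :=
    { toFun := fun σ => ⟨σ.1 * Equiv.swap i l, by
        intro a ha
        have ha : a = i := by simpa using ha
        subst ha
        rw [Equiv.Perm.mul_apply, Equiv.swap_apply_left, ← Equiv.eq_symm_apply]
        apply Fin.ext
        have := σ.2
        simp only [l]; omega⟩
      invFun := fun f => ⟨f.1 * Equiv.swap i l, by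
        have h : f.1 i = i := f.2 i (by simp)
        have : (f.1 * Equiv.swap i l).symm i = l := by
          rw [Equiv.symm_apply_eq, Equiv.Perm.mul_apply, Equiv.swap_apply_right, h]
        rw [this]; simp only [l]; omega⟩
      left_inv := fun σ => by simp [mul_assoc]
      right_inv := fun f => by simp [mul_assoc] }
  rw [Fintype.card_congr (e.trans (Equiv.Perm.subtypeEquivSubtypePerm _).symm),
    Fintype.card_perm, Fintype.card_subtype_compl, Fintype.card_fin,
    Fintype.card_subtype_eq]

theorem card_roommates (n : ℕ) : Fintype.card (Roommates n) = (n - 1).factorial ^ n := by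
  let e : Roommates n ≃ (∀ i : Fin n, Lists i) :=
    { toFun := fun I i => ⟨I.pref i, I.self_last i⟩
      invFun := fun f => ⟨fun i => (f i).1, fun i => (f i).2⟩
      left_inv := fun _ => rfl
      right_inv := fun _ => rfl }
  rw [Fintype.card_congr e, Fintype.card_pi]
  simp [card_lists]

open Classical in
theorem card_better_eq_le {P : Equiv.Perm (Fin n)} (hP : ∀ i, P i ≠ i)
    (A : Fin n → Finset (Fin n)) :
    (Finset.univ.filter fun I : Roommates n => (fun i => I.better i (P.symm i)) = A).card ≤
      ∏ i, ((A i).card.factorial * (n - 2 - (A i).card).factorial) := by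
  calc _ ≤ Fintype.card (∀ i, ListsWith i (P.symm i) (A i)) := by
        rw [← Fintype.card_subtype]
        refine Fintype.card_le_of_injective
          (fun I i => ⟨I.1.pref i, I.1.self_last i, fun j => ?_⟩) ?_
        · rw [← congrFun I.2 i, mem_better, rank_lt_iff]
        · intro I J h
          apply Subtype.ext
          apply pref_injective
          funext i
          have := congrFun h i
          simpa using this
    _ = ∏ i, Fintype.card (ListsWith i (P.symm i) (A i)) := Fintype.card_pi
    _ ≤ _ := Finset.prod_le_prod' fun i _ => card_listsWith_le
        (fun h => hP i (by rw [Equiv.eq_symm_apply] at h; exact h)) _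

/-! ### Stability as a condition on preference sets -/

/-- The constraints which stability of `P` puts on the sets of members preferred to the
predecessors. -/
structure Admissible (P : Equiv.Perm (Fin n)) (A : Fin n → Finset (Fin n)) : Prop where
  self_notMem : ∀ i, i ∉ A i
  pred_notMem : ∀ i, P.symm i ∉ A i
  succ_mem : ∀ i, P (P i) ≠ i → P i ∈ A i
  not_mutual : ∀ i j, i ≠ j → j ≠ P i → i ≠ P j → j ∈ A i → i ∉ A j

theorem IsStable.admissible {I : Roommates n} {P : Equiv.Perm (Fin n)} (h : I.IsStable P) :
    Admissible P fun i => I.better i (P.symm i) where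
  self_notMem i := by
    rw [mem_better, rank_self, not_lt]; exact rank_le _ _ _
  pred_notMem i := by simp [mem_better]
  succ_mem i hi := by
    rw [mem_better]
    refine lt_of_le_of_ne (h.1 i) fun he => hi ?_
    have := I.rank_injective i he
    rw [this]; simp
  not_mutual i j hij h1 h2 h3 := by
    rw [mem_better] at h3 ⊢
    exact not_lt.2 (h.2 i j hij h1 h2 h3).le

/-- The ordered pairs `i < j`, representing the two-element subsets. -/
abbrev Pairs (n : ℕ) : Type := {e : Fin n × Fin n // e.1 < e.2}

theorem prod_offDiag_eq_prod_pairs (F : Fin n → Fin n → ℝ) :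
    ∏ i, ∏ j ∈ Finset.univ.filter (fun j => j ≠ i), F i j =
      ∏ e : Pairs n, F e.1.1 e.1.2 * F e.1.2 e.1.1 := by
  have h1 : ∏ i, ∏ j ∈ Finset.univ.filter (fun j => j ≠ i), F i j =
      (∏ i, ∏ j, if i < j then F i j else 1) * ∏ i, ∏ j, if j < i then F i j else 1 := by
    rw [← Finset.prod_mul_distrib]
    refine Finset.prod_congr rfl fun i _ => ?_
    rw [← Finset.prod_mul_distrib, Finset.prod_filter]
    refine Finset.prod_congr rfl fun j _ => ?_
    rcases lt_trichotomy i j with h | h | h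
    · simp [h, h.ne', h.not_gt]
    · simp [h]
    · simp [h, h.ne, h.not_gt]
  have h2 : (∏ i, ∏ j, if j < i then F i j else 1) = ∏ i, ∏ j, if i < j then F j i else 1 :=
    Finset.prod_comm
  rw [h1, h2, ← Finset.prod_mul_distrib]
  simp_rw [← Finset.prod_mul_distrib]
  rw [← Finset.prod_subtype (Finset.univ.filter fun e : Fin n × Fin n => e.1 < e.2) (by simp)
    (fun e => F e.1 e.2 * F e.2 e.1), Finset.prod_filter, ← Finset.univ_product_univ,
    Finset.prod_product]
  refine Finset.prod_congr rfl fun i _ => Finset.prod_congr rfl fun j _ => ?_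
  split_ifs <;> simp

theorem sum_offDiag_eq_sum_pairs (F : Fin n → Fin n → ℝ) :
    ∑ i, ∑ j ∈ Finset.univ.filter (fun j => j ≠ i), F i j =
      ∑ e : Pairs n, (F e.1.1 e.1.2 + F e.1.2 e.1.1) := by
  -- The additive form is the logarithm of the multiplicative one.
  have := congrArg Real.log (prod_offDiag_eq_prod_pairs fun i j => Real.exp (F i j))
  simpa only [← Real.exp_sum, ← Real.exp_add, Real.log_exp] using this

/-! ### Factorization over pairs for fixed `x` -/

section Pointwise

variable (P : Equiv.Perm (Fin n)) (z : ℝ) (x : Fin n → ℝ)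

/-- The weight of the event that `i` prefers (or does not prefer) `j` to the predecessor. -/
def arcWeight (i j : Fin n) (a : Prop) [Decidable a] : ℝ :=
  if j = P.symm i then 1 else if a then z * x i else 1 - x i

/-- The factor contributed by a forced arc from `i` to its successor `j`. -/
def forcedWeight (i j : Fin n) : ℝ := if j = P i ∧ P j ≠ i then z * x i else 1

/-- The exponent bounding the contribution of the pair `i, j`. -/
def pairExponent (i j : Fin n) : ℝ :=
  if j = P i ∨ i = P j then 0
  else (z - 1) * (x i + x j) - (2 * z - 1) * (x i * x j)

/-- The local form of admissibility, for a pair of members. -/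
def PairAllowed (i j : Fin n) (a b : Prop) : Prop :=
  (j = P.symm i → ¬ a) ∧ (i = P.symm j → ¬ b) ∧ (j = P i → P j ≠ i → a) ∧
    (i = P j → P i ≠ j → b) ∧ (j ≠ P i → i ≠ P j → ¬ (a ∧ b))

theorem Admissible.pairAllowed {A : Fin n → Finset (Fin n)} {P : Equiv.Perm (Fin n)}
    (h : Admissible P A) {i j : Fin n} (hij : i ≠ j) : PairAllowed P i j (j ∈ A i) (i ∈ A j) := by
  refine ⟨?_, ?_, ?_, ?_, ?_⟩
  · rintro rfl; exact h.pred_notMem i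
  · rintro rfl; exact h.pred_notMem j
  · rintro rfl h2; exact h.succ_mem i h2
  · rintro rfl h2; exact h.succ_mem j h2
  · rintro h1 h2 ⟨h3, h4⟩; exact h.not_mutual i j hij h1 h2 h3 h4

/-- Neither `i` nor the predecessor contributes a factor, which leaves `n - 2` members, as in the
Beta integrand. -/
theorem prod_arcWeight {A : Fin n → Finset (Fin n)} (h : Admissible P A) (hP : ∀ i, P i ≠ i)
    (i : Fin n) :
    ∏ j ∈ Finset.univ.filter (fun j => j ≠ i), arcWeight P z x i j (j ∈ A i) =
      (z * x i) ^ (A i).card * (1 - x i) ^ (n - 2 - (A i).card) := by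
  have hpi : P.symm i ≠ i := fun h => hP i (by rw [Equiv.symm_apply_eq] at h; exact h.symm)
  simp only [arcWeight]
  rw [Finset.prod_ite, Finset.prod_const_one, one_mul, Finset.prod_ite, Finset.prod_const,
    Finset.prod_const]
  have h1 : ((Finset.univ.filter (fun j => j ≠ i)).filter (fun j => ¬ j = P.symm i)).filter
      (fun j => j ∈ A i) = A i := by
    ext j
    simp only [Finset.mem_filter, Finset.mem_univ, true_and, and_iff_right_iff_imp]
    intro hj
    exact ⟨fun e => h.self_notMem i (e ▸ hj), fun e => h.pred_notMem i (e ▸ hj)⟩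
  have h2 : ((Finset.univ.filter (fun j => j ≠ i)).filter (fun j => ¬ j = P.symm i)).filter
      (fun j => j ∉ A i) = (insert i (insert (P.symm i) (A i)))ᶜ := by
    ext j
    simp only [Finset.mem_filter, Finset.mem_univ, true_and, Finset.mem_compl,
      Finset.mem_insert, not_or]
    tauto
  have h3 : (insert i (insert (P.symm i) (A i)))ᶜ.card = n - 2 - (A i).card := by
    rw [Finset.card_compl, Finset.card_insert_of_notMem
      (by simp [hpi.symm, h.self_notMem i]), Finset.card_insert_of_notMem (h.pred_notMem i),
      Fintype.card_fin]
    omega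
  rw [h1, h2, h3]

variable {P z x}

/-- For a non-adjacent pair only mutual preference is excluded, and the other three outcomes add up
to exactly `1 + (z-1)(x i + x j) - (2z-1) x i x j`. For an adjacent pair a single outcome remains:
weight `1` in a 2-cycle, otherwise one forced arc. -/
theorem sum_pairAllowed_le {i j : Fin n} [DecidablePred fun ab : Bool × Bool => PairAllowed P i j ab.1 ab.2] :
    ∑ ab ∈ Finset.univ.filter (fun ab : Bool × Bool => PairAllowed P i j ab.1 ab.2),
        arcWeight P z x i j ab.1 * arcWeight P z x j i ab.2 ≤
      (forcedWeight P z x i j * forcedWeight P z x j i) * Real.exp (pairExponent P z x i j) := by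
  classical
  have e1 : (j = P.symm i) ↔ P j = i := Equiv.eq_symm_apply P
  have e2 : (i = P.symm j) ↔ P i = j := Equiv.eq_symm_apply P
  rw [Finset.sum_filter, Fintype.sum_prod_type]
  simp only [Fintype.sum_bool, arcWeight, forcedWeight, pairExponent, PairAllowed, e1, e2]
  by_cases h1 : P i = j <;> by_cases h2 : P j = i
  · simp [h1, h2]
  · simp [h1, h2, Ne.symm h2]
  · simp [h1, h2, Ne.symm h1]
  · have h1' : ¬ j = P i := Ne.symm h1
    have h2' : ¬ i = P j := Ne.symm h2
    simp only [h1, h2, h1', h2']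
    simp
    rw [if_neg fun h => h2' (h h1')]
    have := Real.add_one_le_exp ((z - 1) * (x i + x j) - (2 * z - 1) * (x i * x j))
    linarith

theorem prod_forcedWeight (hP : ∀ i, P i ≠ i) (i : Fin n) :
    ∏ j ∈ Finset.univ.filter (fun j => j ≠ i), forcedWeight P z x i j =
      if P (P i) ≠ i then z * x i else 1 := by
  rw [Finset.prod_eq_single (P i)]
  · simp [forcedWeight]
  · intro j _ hj; simp [forcedWeight, hj]
  · intro h; simp [hP i] at h

-- A family with `i ∉ A i` is determined by its restrictions to pairs, and admissibility implies the
-- local conditions. Enlarging the sum to all locally allowed choices only adds nonnegative terms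
-- and turns it into a product.
open Classical in
theorem sum_admissible_le (hP : ∀ i, P i ≠ i) (hz : 0 ≤ z) (hx : ∀ i, 0 ≤ x i)
    (hx' : ∀ i, x i ≤ 1) :
    ∑ A ∈ Finset.univ.filter (fun A => Admissible P A),
        ∏ i, ((z * x i) ^ (A i).card * (1 - x i) ^ (n - 2 - (A i).card)) ≤
      (∏ i, if P (P i) ≠ i then z * x i else 1) *
        Real.exp (∑ e : Pairs n, pairExponent P z x e.1.1 e.1.2) := by
  have harc : ∀ i j (a : Bool), 0 ≤ arcWeight P z x i j a := by
    intro i j a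
    rw [arcWeight]
    split_ifs
    · exact zero_le_one
    · exact mul_nonneg hz (hx i)
    · linarith [hx' i]
  let T : Pairs n → Finset (Bool × Bool) := fun e =>
    Finset.univ.filter fun ab : Bool × Bool => PairAllowed P e.1.1 e.1.2 ab.1 ab.2
  let G : Pairs n → Bool × Bool → ℝ := fun e ab =>
    arcWeight P z x e.1.1 e.1.2 ab.1 * arcWeight P z x e.1.2 e.1.1 ab.2
  let c : (Fin n → Finset (Fin n)) → Pairs n → Bool × Bool := fun A e =>
    (decide (e.1.2 ∈ A e.1.1), decide (e.1.1 ∈ A e.1.2))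
  have hweight : ∀ A ∈ Finset.univ.filter (fun A => Admissible P A),
      ∏ i, ((z * x i) ^ (A i).card * (1 - x i) ^ (n - 2 - (A i).card)) = ∏ e, G e (c A e) := by
    intro A hA
    have hA : Admissible P A := by simpa using hA
    rw [← Finset.prod_congr rfl fun i _ => prod_arcWeight P z x hA hP i,
      prod_offDiag_eq_prod_pairs fun i j => arcWeight P z x i j (j ∈ A i)]
    simp [G, c, arcWeight]
  have hinj : Set.InjOn c (Finset.univ.filter fun A => Admissible P A : Finset _) := by
    intro A hA B hB hAB
    have hA : Admissible P A := by simpa using hA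
    have hB : Admissible P B := by simpa using hB
    funext i
    ext j
    rcases lt_trichotomy i j with h | h | h
    · have := congrFun hAB ⟨(i, j), h⟩
      simp only [c, Prod.mk.injEq, decide_eq_decide] at this
      exact this.1
    · subst h; simp [hA.self_notMem, hB.self_notMem]
    · have := congrFun hAB ⟨(j, i), h⟩
      simp only [c, Prod.mk.injEq, decide_eq_decide] at this
      exact this.2
  rw [Finset.sum_congr rfl hweight,
    ← Finset.sum_image (s := Finset.univ.filter fun A => Admissible P A) (g := c)
      (f := fun f => ∏ e, G e (f e)) hinj]
  calc _ ≤ ∑ f ∈ Fintype.piFinset T, ∏ e, G e (f e) := by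
        refine Finset.sum_le_sum_of_subset_of_nonneg ?_ fun f _ _ =>
          Finset.prod_nonneg fun e _ => mul_nonneg (harc _ _ _) (harc _ _ _)
        intro f hf
        obtain ⟨A, hA, rfl⟩ := Finset.mem_image.1 hf
        have hA : Admissible P A := by simpa using hA
        rw [Fintype.mem_piFinset]
        intro e
        simpa [T, c] using hA.pairAllowed e.2.ne
    _ = ∏ e, ∑ ab ∈ T e, G e ab := (Finset.prod_univ_sum T G).symm
    _ ≤ ∏ e : Pairs n, ((forcedWeight P z x e.1.1 e.1.2 * forcedWeight P z x e.1.2 e.1.1) *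
          Real.exp (pairExponent P z x e.1.1 e.1.2)) :=
        Finset.prod_le_prod
          (fun e _ => Finset.sum_nonneg fun ab _ => mul_nonneg (harc _ _ _) (harc _ _ _))
          (fun e _ => sum_pairAllowed_le)
    _ = _ := by
        rw [Finset.prod_mul_distrib, ← prod_offDiag_eq_prod_pairs, Real.exp_sum]
        simp_rw [prod_forcedWeight hP]

end Pointwise

open MeasureTheory

/-! ### Bounds for the total exponent -/

theorem sum_pairExponent_le {P : Equiv.Perm (Fin n)} {z : ℝ} {x : Fin n → ℝ}
    (hz : |z - 1| ≤ 1 / 2) (hx : ∀ i, 0 ≤ x i) (hx' : ∀ i, x i ≤ 1) :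
    ∑ e : Pairs n, pairExponent P z x e.1.1 e.1.2 ≤
      (z - 1) * n * (∑ i, x i) - (2 * z - 1) * (∑ i, x i) ^ 2 / 2 + 5 * ∑ i, x i := by
  obtain ⟨hz1, hz2⟩ := abs_le.1 hz
  set s := ∑ i, x i with hs
  have hs0 : 0 ≤ s := Finset.sum_nonneg fun i _ => hx i
  have hsymm : ∀ i j, pairExponent P z x i j = pairExponent P z x j i := by
    intro i j
    simp only [pairExponent, or_comm (a := j = P i), add_comm (x i), mul_comm (x i)]
  have h1 : 2 * ∑ e : Pairs n, pairExponent P z x e.1.1 e.1.2 =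
      ∑ i, ∑ j, if j ≠ i then pairExponent P z x i j else 0 := by
    simp_rw [← Finset.sum_filter]
    rw [sum_offDiag_eq_sum_pairs, Finset.mul_sum]
    refine Finset.sum_congr rfl fun e _ => ?_
    rw [hsymm e.1.2]; ring
  -- Diagonal and adjacent pairs lack the full expression. It is at least `-3/2 (x i + x j)`,
  -- because `z - 1 ≥ -1/2`, `2z - 1 ≤ 2` and `x i x j ≤ (x i + x j)/2`.
  have h2 : ∀ i j, (if j ≠ i then pairExponent P z x i j else 0) ≤
      ((z - 1) * (x i + x j) - (2 * z - 1) * (x i * x j)) +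
      ((if i = j then 3 / 2 * (x i + x j) else 0) + (if P i = j then 3 / 2 * (x i + x j) else 0) +
        if i = P j then 3 / 2 * (x i + x j) else 0) := by
    intro i j
    have hc : 0 ≤ 3 / 2 * (x i + x j) := by linarith [hx i, hx j]
    have hfull : 0 ≤ ((z - 1) * (x i + x j) - (2 * z - 1) * (x i * x j)) +
        3 / 2 * (x i + x j) := by
      have := mul_nonneg (hx i) (hx j)
      have := mul_nonneg (hx i) (sub_nonneg.2 (hx' j))
      have := mul_nonneg (hx j) (sub_nonneg.2 (hx' i))
      nlinarith [mul_nonneg (by linarith : 0 ≤ z - 1 + 1 / 2) (hx i),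
        mul_nonneg (by linarith : 0 ≤ z - 1 + 1 / 2) (hx j),
        mul_nonneg (by linarith : 0 ≤ 3 / 2 - z) (mul_nonneg (hx i) (hx j))]
    have hpos : ∀ p : Prop, ∀ [Decidable p], 0 ≤ if p then 3 / 2 * (x i + x j) else 0 := by
      intro p _; split_ifs <;> [exact hc; exact le_rfl]
    by_cases a1 : i = j
    · rw [if_neg (by simp [a1]), if_pos a1]
      linarith [hpos (P i = j), hpos (i = P j)]
    by_cases a2 : P i = j
    · rw [if_pos (Ne.symm a1), pairExponent, if_pos (Or.inl a2.symm), if_pos a2]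
      linarith [hpos (i = j), hpos (i = P j)]
    by_cases a3 : i = P j
    · rw [if_pos (Ne.symm a1), pairExponent, if_pos (Or.inr a3), if_pos a3]
      linarith [hpos (i = j), hpos (P i = j)]
    rw [if_pos (Ne.symm a1), pairExponent, if_neg (by rintro (h | h); exacts [a2 h.symm, a3 h])]
    linarith [hpos (i = j), hpos (P i = j), hpos (i = P j)]
  have hperm : ∑ i, x (P i) = s := Equiv.sum_comp P x
  have h3 := Finset.sum_le_sum fun i (_ : i ∈ Finset.univ) =>
    Finset.sum_le_sum fun j (_ : j ∈ Finset.univ) => h2 i j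
  rw [← h1] at h3
  have h4 : ∑ i, ∑ j, ((z - 1) * (x i + x j) - (2 * z - 1) * (x i * x j)) =
      2 * ((z - 1) * n * s) - (2 * z - 1) * s ^ 2 := by
    simp only [Finset.sum_sub_distrib, ← Finset.mul_sum, Finset.sum_add_distrib,
      Finset.sum_const, ← Finset.sum_mul, ← hs, Finset.card_univ, Fintype.card_fin, nsmul_eq_mul]
    ring
  -- Each of the three corrections sums to `3 s`. Halving for unordered pairs leaves `9/2 s`,
  -- rounded up to `5 s`.
  have h5 : ∑ i, ∑ j, ((if i = j then 3 / 2 * (x i + x j) else 0) +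
      (if P i = j then 3 / 2 * (x i + x j) else 0) +
        if i = P j then 3 / 2 * (x i + x j) else 0) = 9 * s := by
    simp_rw [Finset.sum_add_distrib]
    rw [Finset.sum_comm (f := fun i j => if i = P j then 3 / 2 * (x i + x j) else 0)]
    simp only [Finset.sum_ite_eq, Finset.sum_ite_eq', Finset.mem_univ, if_true]
    simp_rw [← Finset.mul_sum, Finset.sum_add_distrib, hperm, ← hs]
    ring
  simp_rw [Finset.sum_add_distrib (f := fun j => (z - 1) * (x _ + x j) - _)] at h3
  rw [Finset.sum_add_distrib, h4, h5] at h3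
  nlinarith

/-- The inequality `s² ≥ 2 √n s - n` makes the exponent a sum over members, so that the integral
over `x` factors. The `9` is the earlier `5` plus `4` from `-2 (z-1) √n s ≤ 4 s`. -/
theorem sum_pairExponent_le_linear {P : Equiv.Perm (Fin n)} {z : ℝ} {x : Fin n → ℝ}
    (hz : |z - 1| ≤ 1 / 2) (hz' : |z - 1| * √n ≤ 2) (hx : ∀ i, 0 ≤ x i) (hx' : ∀ i, x i ≤ 1) :
    ∑ e : Pairs n, pairExponent P z x e.1.1 e.1.2 ≤
      (n / 2 + (z - 1) * n) + ∑ i, -((√n - (z - 1) * n - 9) * x i) := by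
  have h1 := sum_pairExponent_le (P := P) hz hx hx'
  rw [Finset.sum_neg_distrib, ← Finset.mul_sum]
  set s := ∑ i, x i
  have hs0 : 0 ≤ s := Finset.sum_nonneg fun i _ => hx i
  have hn : √(n : ℝ) ^ 2 = n := Real.sq_sqrt (Nat.cast_nonneg n)
  have h2 : -((z - 1) * √n * s) ≤ 2 * s := by
    have : -((z - 1) * √n) ≤ 2 := by
      refine le_trans ?_ hz'
      nlinarith [neg_abs_le (z - 1), Real.sqrt_nonneg (n : ℝ)]
    nlinarith
  have h3 : 0 ≤ (2 * z - 1) * (s - √n) ^ 2 :=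
    mul_nonneg (by linarith [(abs_le.1 hz).1]) (sq_nonneg _)
  have h4 : (2 * z - 1) * (s - √n) ^ 2 = (2 * z - 1) * s ^ 2 - 2 * (√n * s) -
      4 * ((z - 1) * √n * s) + (2 * z - 1) * √n ^ 2 := by ring
  rw [hn] at h4
  linarith

/-! ### One-dimensional integrals -/

theorem integral_pow_mul_one_sub_pow (d e : ℕ) :
    ∫ t in (0 : ℝ)..1, t ^ d * (1 - t) ^ e =
      (d.factorial * e.factorial : ℝ) / (d + e + 1).factorial := by
  induction e generalizing d with
  | zero =>
    have : ((d + 1).factorial : ℝ) = (d + 1) * d.factorial := by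
      rw [Nat.factorial_succ]; push_cast; ring
    have h0 : (d.factorial : ℝ) ≠ 0 := by positivity
    have h1 : (d : ℝ) + 1 ≠ 0 := by positivity
    simp [integral_pow, this]
    field_simp
  | succ e ih =>
    have hparts := intervalIntegral.integral_mul_deriv_eq_deriv_mul (a := (0 : ℝ)) (b := 1)
      (u := fun t : ℝ => (1 - t) ^ (e + 1)) (u' := fun t : ℝ => -((e + 1 : ℝ) * (1 - t) ^ e))
      (v := fun t : ℝ => t ^ (d + 1)) (v' := fun t : ℝ => (d + 1 : ℝ) * t ^ d)
      (fun t _ => by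
        refine (((hasDerivAt_id t).const_sub 1).fun_pow (e + 1)).congr_deriv ?_
        simp)
      (fun t _ => by
        refine ((hasDerivAt_id t).fun_pow (d + 1)).congr_deriv ?_
        simp)
      (by apply Continuous.intervalIntegrable; fun_prop)
      (by apply Continuous.intervalIntegrable; fun_prop)
    have h1 : ∫ t in (0 : ℝ)..1, (1 - t) ^ (e + 1) * ((d + 1 : ℝ) * t ^ d) =
        (d + 1) * ∫ t in (0 : ℝ)..1, t ^ d * (1 - t) ^ (e + 1) := by
      rw [← intervalIntegral.integral_const_mul]
      congr 1; ext t; ring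
    have h2 : ∫ t in (0 : ℝ)..1, -((e + 1 : ℝ) * (1 - t) ^ e) * t ^ (d + 1) =
        -((e + 1) * ∫ t in (0 : ℝ)..1, t ^ (d + 1) * (1 - t) ^ e) := by
      rw [← intervalIntegral.integral_const_mul, ← intervalIntegral.integral_neg]
      congr 1; ext t; ring
    rw [h1, h2, ih (d + 1)] at hparts
    have h3 : d + 1 + e + 1 = d + (e + 1) + 1 := by ring
    rw [h3] at hparts
    have h4 : (d : ℝ) + 1 ≠ 0 := by positivity
    simp only [sub_self, ne_eq, Nat.add_eq_zero_iff, one_ne_zero, and_false, not_false_eq_true,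
      zero_pow, zero_mul, mul_zero, sub_neg_eq_add, zero_add, sub_zero] at hparts
    rw [← mul_right_inj' h4, hparts, Nat.factorial_succ d, Nat.factorial_succ e]
    push_cast
    ring

theorem integral_exp_neg_mul_le {b : ℝ} (hb : 0 < b) :
    ∫ t in (0 : ℝ)..1, Real.exp (-(b * t)) ≤ b⁻¹ := by
  have hd : ∀ t ∈ Set.uIcc (0 : ℝ) 1,
      HasDerivAt (fun t : ℝ => -(b⁻¹ * Real.exp (-(b * t)))) (Real.exp (-(b * t))) t := by
    intro t _
    refine (((((hasDerivAt_id t).const_mul b).fun_neg).exp).const_mul b⁻¹).fun_neg.congr_deriv ?_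
    simp; field_simp
  rw [intervalIntegral.integral_eq_sub_of_hasDerivAt hd
    (by apply Continuous.intervalIntegrable; fun_prop)]
  have := mul_pos (inv_pos.2 hb) (Real.exp_pos (-b))
  simp
  linarith

theorem integral_id_mul_exp_neg_mul_le {b : ℝ} (hb : 0 < b) :
    ∫ t in (0 : ℝ)..1, t * Real.exp (-(b * t)) ≤ b⁻¹ * b⁻¹ := by
  have hd : ∀ t ∈ Set.uIcc (0 : ℝ) 1,
      HasDerivAt (fun t : ℝ => -((b⁻¹ * t + b⁻¹ * b⁻¹) * Real.exp (-(b * t))))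
        (t * Real.exp (-(b * t))) t := by
    intro t _
    refine ((((hasDerivAt_id t).const_mul b⁻¹).add_const (b⁻¹ * b⁻¹)).fun_mul
      ((((hasDerivAt_id t).const_mul b).fun_neg).exp)).fun_neg.congr_deriv ?_
    simp; field_simp; ring
  rw [intervalIntegral.integral_eq_sub_of_hasDerivAt hd
    (by apply Continuous.intervalIntegrable; fun_prop)]
  have := mul_pos (inv_pos.2 hb) (Real.exp_pos (-b))
  have := mul_pos (inv_pos.2 hb) this
  simp
  nlinarith

/-! ### The weighted probability of stability for a fixed permutation -/

theorem Admissible.card_add_two_le {P : Equiv.Perm (Fin n)} {A : Fin n → Finset (Fin n)}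
    (h : Admissible P A) (hP : ∀ i, P i ≠ i) (i : Fin n) : (A i).card + 2 ≤ n := by
  have hpi : i ≠ P.symm i := fun h => hP i (by rw [Equiv.eq_symm_apply] at h; exact h)
  have h1 : (insert i (insert (P.symm i) (A i))).card = (A i).card + 2 := by
    rw [Finset.card_insert_of_notMem (by simp [hpi, h.self_notMem i]),
      Finset.card_insert_of_notMem (h.pred_notMem i)]
  rw [← h1]
  exact (Finset.card_le_univ _).trans_eq (Fintype.card_fin n)

open Classical in
theorem sum_stable_le {P : Equiv.Perm (Fin n)} (hP : ∀ i, P i ≠ i) {z : ℝ} (hz : 0 ≤ z) :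
    (∑ I ∈ Finset.univ.filter (fun I : Roommates n => I.IsStable P),
        z ^ ∑ i, (I.better i (P.symm i)).card) / Fintype.card (Roommates n) ≤
      ∑ A ∈ Finset.univ.filter (fun A => Admissible P A),
        ∏ i, ∫ t in Set.Ioc (0 : ℝ) 1, (z * t) ^ (A i).card * (1 - t) ^ (n - 2 - (A i).card) := by
  have hmaps : ∀ I ∈ Finset.univ.filter (fun I : Roommates n => I.IsStable P),
      (fun i => I.better i (P.symm i)) ∈ Finset.univ.filter (fun A => Admissible P A) := by
    intro I hI
    have hI : I.IsStable P := by simpa using hI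
    simpa using hI.admissible
  rw [← Finset.sum_fiberwise_of_maps_to hmaps, Finset.sum_div]
  refine Finset.sum_le_sum fun A hA => ?_
  have hA : Admissible P A := by simpa using hA
  have hint : ∀ i, ∫ t in Set.Ioc (0 : ℝ) 1,
      (z * t) ^ (A i).card * (1 - t) ^ (n - 2 - (A i).card) =
        z ^ (A i).card * (((A i).card.factorial * (n - 2 - (A i).card).factorial : ℕ) /
          (n - 1).factorial) := by
    intro i
    have h2 := hA.card_add_two_le hP i
    have h3 : (A i).card + (n - 2 - (A i).card) + 1 = n - 1 := by omega
    have h4 := integral_pow_mul_one_sub_pow (A i).card (n - 2 - (A i).card)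
    rw [h3, intervalIntegral.integral_of_le zero_le_one] at h4
    rw [Nat.cast_mul, ← h4, ← integral_const_mul]
    congr 1; ext t; rw [mul_pow, mul_assoc]
  simp_rw [hint]
  rw [Finset.prod_mul_distrib, Finset.prod_pow_eq_pow_sum, Finset.prod_div_distrib,
    Finset.prod_const, Finset.card_univ, Fintype.card_fin, card_roommates, Nat.cast_pow,
    ← mul_div_assoc]
  refine div_le_div_of_nonneg_right ?_ (by positivity)
  calc _ = ∑ I ∈ (Finset.univ.filter (fun I : Roommates n => I.IsStable P)).filter
          (fun I => (fun i => I.better i (P.symm i)) = A), z ^ ∑ i, (A i).card := by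
        refine Finset.sum_congr rfl fun I hI => ?_
        have := (Finset.mem_filter.1 hI).2
        simp only [← this]
    _ ≤ z ^ (∑ i, (A i).card) *
        ((Finset.univ.filter fun I : Roommates n =>
          (fun i => I.better i (P.symm i)) = A).card : ℝ) := by
        rw [Finset.sum_const, nsmul_eq_mul, mul_comm]
        refine mul_le_mul_of_nonneg_left ?_ (pow_nonneg hz _)
        exact_mod_cast Finset.card_le_card (Finset.filter_subset_filter _ (Finset.subset_univ _))
    _ ≤ _ := by
        refine mul_le_mul_of_nonneg_left ?_ (pow_nonneg hz _)
        exact_mod_cast card_better_eq_le hP A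

/-- The number of members in cycles of length other than two, for `P` without fixed points. -/
def longCard (P : Equiv.Perm (Fin n)) : ℕ := (Finset.univ.filter fun i => P (P i) ≠ i).card

theorem integral_weight_le {z b : ℝ} (hz : 0 ≤ z) (hb : 0 < b) (p : Prop) [Decidable p] :
    ∫ t in Set.Ioc (0 : ℝ) 1, (if p then z * t else 1) * Real.exp (-(b * t)) ≤
      b⁻¹ * if p then z / b else 1 := by
  rw [← intervalIntegral.integral_of_le zero_le_one]
  split_ifs
  · simp_rw [mul_assoc]
    rw [intervalIntegral.integral_const_mul]
    refine (mul_le_mul_of_nonneg_left (integral_id_mul_exp_neg_mul_le hb) hz).trans_eq ?_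
    rw [div_eq_mul_inv]; ring
  · simpa using integral_exp_neg_mul_le hb

-- The finite sum over `A` moves inside an integral over the cube, where the pointwise bound
-- applies. The exponent being linear in `x`, the integral is again a product.
open Classical in
theorem sum_stable_le_of_exponent {P : Equiv.Perm (Fin n)} (hP : ∀ i, P i ≠ i) {z a b : ℝ}
    (hz : 0 ≤ z) (hb : 0 < b)
    (hexp : ∀ x : Fin n → ℝ, (∀ i, 0 ≤ x i) → (∀ i, x i ≤ 1) →
      ∑ e : Pairs n, pairExponent P z x e.1.1 e.1.2 ≤ a + ∑ i, -(b * x i)) :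
    (∑ I ∈ Finset.univ.filter (fun I : Roommates n => I.IsStable P),
        z ^ ∑ i, (I.better i (P.symm i)).card) / Fintype.card (Roommates n) ≤
      Real.exp a * (b⁻¹ ^ n * (z / b) ^ longCard P) := by
  set ν : Measure ℝ := volume.restrict (Set.Ioc (0 : ℝ) 1) with hν
  have hint : ∀ f : ℝ → ℝ, Continuous f → Integrable f ν := by
    intro f hf
    have := hf.intervalIntegrable (μ := volume) 0 1
    rwa [intervalIntegrable_iff_integrableOn_Ioc_of_le zero_le_one] at this
  have hae : ∀ᵐ x ∂(Measure.pi fun _ : Fin n => ν), ∀ i, 0 ≤ x i ∧ x i ≤ 1 := by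
    rw [ae_all_iff]
    intro i
    have h1 : ∀ᵐ t ∂ν, 0 ≤ t ∧ t ≤ 1 :=
      (ae_restrict_mem measurableSet_Ioc).mono fun t ht => ⟨ht.1.le, ht.2⟩
    exact (Measure.tendsto_eval_ae_ae (μ := fun _ : Fin n => ν) (i := i)).eventually h1
  have hI : ∀ A : Fin n → Finset (Fin n), Integrable (fun x : Fin n → ℝ =>
      ∏ i, ((z * x i) ^ (A i).card * (1 - x i) ^ (n - 2 - (A i).card)))
      (Measure.pi fun _ => ν) := by
    intro A
    exact Integrable.fintype_prod
      (f := fun i t => (z * t) ^ (A i).card * (1 - t) ^ (n - 2 - (A i).card))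
      fun i => hint _ (by fun_prop)
  have hJ : Integrable (fun x : Fin n → ℝ =>
      ∏ i, ((if P (P i) ≠ i then z * x i else 1) * Real.exp (-(b * x i))))
      (Measure.pi fun _ => ν) := by
    refine Integrable.fintype_prod
      (f := fun i t => (if P (P i) ≠ i then z * t else 1) * Real.exp (-(b * t)))
      fun i => hint _ ?_
    split_ifs <;> fun_prop
  calc _ ≤ ∑ A ∈ Finset.univ.filter (fun A => Admissible P A),
        ∏ i, ∫ t, (z * t) ^ (A i).card * (1 - t) ^ (n - 2 - (A i).card) ∂ν := sum_stable_le hP hz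
    _ = ∫ x, ∑ A ∈ Finset.univ.filter (fun A => Admissible P A),
        ∏ i, ((z * x i) ^ (A i).card * (1 - x i) ^ (n - 2 - (A i).card))
          ∂(Measure.pi fun _ => ν) := by
        rw [integral_finsetSum _ fun A _ => hI A]
        refine Finset.sum_congr rfl fun A _ => ?_
        exact (integral_fintype_prod_eq_prod
          (fun i t => (z * t) ^ (A i).card * (1 - t) ^ (n - 2 - (A i).card))).symm
    _ ≤ ∫ x, Real.exp a *
        ∏ i, ((if P (P i) ≠ i then z * x i else 1) * Real.exp (-(b * x i)))
          ∂(Measure.pi fun _ => ν) := by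
        refine integral_mono_ae (integrable_finsetSum _ fun A _ => hI A) (hJ.const_mul _) ?_
        filter_upwards [hae] with x hx
        refine (sum_admissible_le hP hz (fun i => (hx i).1) fun i => (hx i).2).trans ?_
        rw [Finset.prod_mul_distrib, ← Real.exp_sum, mul_left_comm, ← Real.exp_add]
        refine mul_le_mul_of_nonneg_left (Real.exp_le_exp.2
          (hexp x (fun i => (hx i).1) fun i => (hx i).2)) (Finset.prod_nonneg fun i _ => ?_)
        split_ifs
        exacts [mul_nonneg hz (hx i).1, zero_le_one]
    _ = Real.exp a *
        ∏ i, ∫ t, (if P (P i) ≠ i then z * t else 1) * Real.exp (-(b * t)) ∂ν := by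
        rw [integral_const_mul, integral_fintype_prod_eq_prod
          (fun i t => (if P (P i) ≠ i then z * t else 1) * Real.exp (-(b * t)))]
    _ ≤ Real.exp a * ∏ i, (b⁻¹ * if P (P i) ≠ i then z / b else 1) := by
        refine mul_le_mul_of_nonneg_left (Finset.prod_le_prod (fun i _ => ?_)
          fun i _ => integral_weight_le hz hb _) (Real.exp_pos _).le
        refine integral_nonneg_of_ae ?_
        filter_upwards [ae_restrict_mem measurableSet_Ioc] with t ht
        refine mul_nonneg ?_ (Real.exp_pos _).le
        split_ifs
        exacts [mul_nonneg hz ht.1.le, zero_le_one]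
    _ = _ := by
        rw [Finset.prod_mul_distrib, Finset.prod_const, Finset.card_univ, Fintype.card_fin,
          Finset.prod_ite, Finset.prod_const, Finset.prod_const_one, mul_one, longCard]

/-! ### Counting permutations by the members outside 2-cycles -/

theorem card_involutions_le {α : Type*} [Fintype α] [DecidableEq α]
    (s : Finset (Equiv.Perm α)) (hs : ∀ f ∈ s, (∀ i, f (f i) = i) ∧ ∀ i, f i ≠ i) :
    s.card ≤ if Even (Fintype.card α) then
      (Fintype.card α).factorial / (2 ^ (Fintype.card α / 2) * (Fintype.card α / 2).factorial)
      else 0 := by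
  have : Fact (Nat.Prime 2) := ⟨Nat.prime_two⟩
  have hct : ∀ f ∈ s, f.cycleType = Multiset.replicate (Fintype.card α / 2) 2 ∧
      Even (Fintype.card α) := by
    intro f hf
    have h1 : f.cycleType = Multiset.replicate f.cycleType.card 2 := by
      rw [Multiset.eq_replicate_card, ← Equiv.Perm.pow_prime_eq_one_iff]
      ext i
      simp [pow_two, (hs f hf).1]
    have h2 : f.cycleType.sum = Fintype.card α := by
      rw [Equiv.Perm.sum_cycleType, ← Finset.card_univ]
      congr 1
      ext i
      simpa using (hs f hf).2 i
    rw [h1, Multiset.sum_replicate, smul_eq_mul] at h2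
    rw [h1, ← h2]
    simp
  split_ifs with he
  · refine (Finset.card_le_card (t := Finset.univ.filter fun g : Equiv.Perm α =>
      g.cycleType = Multiset.replicate (Fintype.card α / 2) 2) ?_).trans ?_
    · intro f hf
      simpa using (hct f hf).1
    · obtain ⟨m, hm⟩ := he
      have hm2 : Fintype.card α / 2 = m := by omega
      rw [Nat.le_div_iff_mul_le (by positivity)]
      have h := Equiv.Perm.card_of_cycleType_mul_eq α (Multiset.replicate (Fintype.card α / 2) 2)
      rw [hm2] at h ⊢
      have hsum : (Multiset.replicate m 2).sum = Fintype.card α := by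
        rw [Multiset.sum_replicate, smul_eq_mul]; omega
      rw [hsum, Nat.sub_self, Nat.factorial_zero, one_mul, Multiset.prod_replicate,
        if_pos ⟨le_rfl, fun a ha => (Multiset.eq_of_mem_replicate ha).ge⟩] at h
      rw [← h]
      refine Nat.mul_le_mul_left _ (Nat.mul_le_mul_left _ ?_)
      rcases Nat.eq_zero_or_pos m with rfl | hpos
      · simp
      · rw [Multiset.toFinset_replicate, if_neg hpos.ne']
        simp
  · rw [Nat.le_zero, Finset.card_eq_zero, Finset.eq_empty_iff_forall_notMem]
    exact fun f hf => he (hct f hf).2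

/-- The members in cycles of length other than two, for `P` without fixed points. -/
def longSet (P : Equiv.Perm (Fin n)) : Finset (Fin n) := Finset.univ.filter fun i => P (P i) ≠ i

theorem mem_longSet {P : Equiv.Perm (Fin n)} {i : Fin n} : i ∈ longSet P ↔ P (P i) ≠ i := by
  simp [longSet]

theorem apply_mem_longSet {P : Equiv.Perm (Fin n)} (i : Fin n) :
    P i ∈ longSet P ↔ i ∈ longSet P := by
  simp [mem_longSet]

/-- The number of involutions without fixed points on a set with `r` elements. -/
def involutionCount (r : ℕ) : ℕ :=
  if Even r then r.factorial / (2 ^ (r / 2) * (r / 2).factorial) else 0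

/-- `P` preserves `T`. It restricts to an arbitrary permutation there and to a fixed-point-free
involution on the complement. -/
theorem card_longSet_eq_le (T : Finset (Fin n)) :
    (Finset.univ.filter fun P : Equiv.Perm (Fin n) => (∀ i, P i ≠ i) ∧ longSet P = T).card ≤
      T.card.factorial * involutionCount (n - T.card) := by
  classical
  set S := Finset.univ.filter fun f : Equiv.Perm {i // i ∉ T} =>
    (∀ i, f (f i) = i) ∧ ∀ i, f i ≠ i with hS
  have hcard : Fintype.card {i // i ∉ T} = n - T.card := by
    rw [Fintype.card_subtype_compl, Fintype.card_fin, Fintype.card_coe]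
  have hSle : S.card ≤ involutionCount (n - T.card) := by
    have := card_involutions_le S fun f hf => (Finset.mem_filter.1 hf).2
    rwa [hcard] at this
  have hmem : ∀ P : {P : Equiv.Perm (Fin n) // (∀ i, P i ≠ i) ∧ longSet P = T}, ∀ i,
      P.1 i ∈ T ↔ i ∈ T := by
    intro P i
    have h := apply_mem_longSet (P := P.1) i
    rwa [P.2.2] at h
  let f : {P : Equiv.Perm (Fin n) // (∀ i, P i ≠ i) ∧ longSet P = T} →
      Equiv.Perm {i // i ∈ T} × S := fun P =>
    (P.1.subtypePerm (hmem P), ⟨P.1.subtypePerm fun i => not_congr (hmem P i), by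
      rw [hS, Finset.mem_filter]
      refine ⟨Finset.mem_univ _, fun i => Subtype.ext ?_, fun i h => P.2.1 i ?_⟩
      · have h1 : (i : Fin n) ∉ longSet P.1 := by rw [P.2.2]; exact i.2
        rw [mem_longSet, not_not] at h1
        exact h1
      · exact congrArg Subtype.val h⟩)
  have hf : Function.Injective f := by
    intro P Q h
    apply Subtype.ext
    ext i
    simp only [f, Prod.mk.injEq, Subtype.mk.injEq] at h
    by_cases hi : i ∈ T
    · have := congrArg Subtype.val (Equiv.congr_fun h.1 ⟨i, hi⟩)
      exact congrArg Fin.val this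
    · have := congrArg Subtype.val (Equiv.congr_fun h.2 ⟨i, hi⟩)
      exact congrArg Fin.val this
  rw [← Fintype.card_subtype]
  refine (Fintype.card_le_of_injective f hf).trans ?_
  rw [Fintype.card_prod, Fintype.card_perm, Fintype.card_coe, Fintype.card_coe]
  exact Nat.mul_le_mul_left _ hSle

theorem sum_pow_longCard_le (n : ℕ) {w : ℝ} (hw : 0 ≤ w) :
    ∑ P ∈ Finset.univ.filter (fun P : Equiv.Perm (Fin n) => ∀ i, P i ≠ i), w ^ longCard P ≤
      ∑ k ∈ Finset.range (n + 1),
        ((n.choose k * k.factorial * involutionCount (n - k) : ℕ) : ℝ) * w ^ k := by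
  classical
  rw [← Finset.sum_fiberwise_of_maps_to (g := longSet)
    (t := (Finset.univ : Finset (Fin n)).powerset) (by simp)]
  calc _ ≤ ∑ T ∈ (Finset.univ : Finset (Fin n)).powerset,
        ((T.card.factorial * involutionCount (n - T.card) : ℕ) : ℝ) * w ^ T.card := by
        refine Finset.sum_le_sum fun T _ => ?_
        rw [Finset.filter_filter]
        calc _ = ∑ P ∈ Finset.univ.filter
              (fun P : Equiv.Perm (Fin n) => (∀ i, P i ≠ i) ∧ longSet P = T), w ^ T.card := by
              refine Finset.sum_congr rfl fun P hP => ?_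
              rw [← (Finset.mem_filter.1 hP).2.2]
              rfl
          _ ≤ _ := by
              rw [Finset.sum_const, nsmul_eq_mul]
              exact mul_le_mul_of_nonneg_right (by exact_mod_cast card_longSet_eq_le T)
                (pow_nonneg hw _)
    _ = _ := by
        rw [Finset.sum_powerset_apply_card
          (fun k => ((k.factorial * involutionCount (n - k) : ℕ) : ℝ) * w ^ k)]
        rw [Finset.card_univ, Fintype.card_fin]
        refine Finset.sum_congr rfl fun k _ => ?_
        rw [nsmul_eq_mul]; push_cast; ring

/-- This is `(1 + 1/m)^(m+1) ≥ e` without division; it drives the induction in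
`factorial_two_mul_le`. -/
theorem exp_one_mul_pow_succ_le (m : ℕ) :
    Real.exp 1 * (m : ℝ) ^ (m + 1) ≤ ((m : ℝ) + 1) ^ (m + 1) := by
  have hm : (0 : ℝ) < m + 1 := by positivity
  have h1 : (m : ℝ) / (m + 1) ≤ Real.exp (-(1 / (m + 1))) := by
    have := Real.add_one_le_exp (-(1 / ((m : ℝ) + 1)))
    refine le_trans (le_of_eq ?_) this
    field_simp; ring
  have h2 := pow_le_pow_left₀ (by positivity) h1 (m + 1)
  rw [← Real.exp_nat_mul, div_pow, div_le_iff₀ (by positivity)] at h2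
  have h3 : ((m + 1 : ℕ) : ℝ) * -(1 / ((m : ℝ) + 1)) = -1 := by
    push_cast; field_simp
  rw [h3] at h2
  calc _ ≤ Real.exp 1 * (Real.exp (-1) * ((m : ℝ) + 1) ^ (m + 1)) :=
        mul_le_mul_of_nonneg_left h2 (Real.exp_pos _).le
    _ = _ := by rw [← mul_assoc, ← Real.exp_add]; simp

/-- A bound of Stirling type for the number of perfect matchings. -/
theorem factorial_two_mul_le {m : ℕ} (hm : 1 ≤ m) :
    ((2 * m).factorial : ℝ) * Real.exp m ≤
      (2 ^ m * m.factorial) * (Real.exp 1 * m * (2 * m : ℝ) ^ m) := by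
  induction m, hm using Nat.le_induction with
  | base => norm_num [Nat.factorial]; linarith [Real.exp_pos 1]
  | succ m hm ih =>
    have h1 : ((2 * (m + 1)).factorial : ℝ) = (2 * (m + 1)) * (2 * m + 1) * (2 * m).factorial := by
      rw [show 2 * (m + 1) = 2 * m + 1 + 1 by ring, Nat.factorial_succ, Nat.factorial_succ]
      push_cast; ring
    have h2 : ((m + 1).factorial : ℝ) = (m + 1) * m.factorial := by
      rw [Nat.factorial_succ]; push_cast; ring
    have h3 : Real.exp ((m + 1 : ℕ) : ℝ) = Real.exp m * Real.exp 1 := by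
      rw [← Real.exp_add]; push_cast; rfl
    have h4 := exp_one_mul_pow_succ_le m
    have hf : (0 : ℝ) < m.factorial := by positivity
    have he := Real.exp_pos 1
    rw [h1, h2, h3]
    calc _ = (2 * (m + 1)) * (2 * m + 1) * Real.exp 1 * (((2 * m).factorial : ℝ) * Real.exp m) := by
          ring
      _ ≤ (2 * (m + 1)) * (2 * m + 1) * Real.exp 1 *
          ((2 ^ m * m.factorial) * (Real.exp 1 * m * (2 * m : ℝ) ^ m)) :=
          mul_le_mul_of_nonneg_left ih (by positivity)
      _ = (2 ^ (m + 1) * 2 ^ m * (m + 1) * (2 * m + 1) * m.factorial * Real.exp 1) *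
          (Real.exp 1 * (m : ℝ) ^ (m + 1)) := by
          rw [mul_pow]; ring
      _ ≤ (2 ^ (m + 1) * 2 ^ m * (m + 1) * (2 * m + 2) * m.factorial * Real.exp 1) *
          ((m : ℝ) + 1) ^ (m + 1) := by
          gcongr; norm_num
      _ = _ := by
          push_cast
          rw [mul_pow]; ring

theorem two_pow_mul_descFactorial_le {m j : ℕ} (hm : 1 ≤ m) (hj : j ≤ m) :
    (2 : ℝ) ^ j * m.descFactorial j ≤
      (2 * m : ℝ) ^ j * Real.exp (-((j : ℝ) * (j - 1) / (2 * m))) := by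
  induction j with
  | zero => simp
  | succ j ih =>
    have hm0 : (0 : ℝ) < m := by exact_mod_cast hm
    have hsub : ((m - j : ℕ) : ℝ) = m - j := by
      rw [Nat.cast_sub (by omega)]
    have h1 : (2 : ℝ) * (m - j) ≤ 2 * m * Real.exp (-(j / m)) := by
      have := Real.add_one_le_exp (-((j : ℝ) / m))
      have h2 : (2 : ℝ) * (m - j) = 2 * m * (-(j / m) + 1) := by field_simp; ring
      rw [h2]
      exact mul_le_mul_of_nonneg_left this (by positivity)
    have h0 : (0 : ℝ) ≤ 2 * (m - j) := by
      have : (j : ℝ) ≤ m := by exact_mod_cast (by omega : j ≤ m)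
      linarith
    rw [Nat.descFactorial_succ, Nat.cast_mul, hsub]
    calc (2 : ℝ) ^ (j + 1) * ((m - j) * m.descFactorial j) =
          (2 * (m - j)) * (2 ^ j * m.descFactorial j) := by ring
      _ ≤ (2 * m * Real.exp (-(j / m))) *
          ((2 * m : ℝ) ^ j * Real.exp (-((j : ℝ) * (j - 1) / (2 * m)))) :=
          mul_le_mul h1 (ih (by omega)) (by positivity) (by positivity)
      _ = (2 * m : ℝ) ^ (j + 1) *
          (Real.exp (-(j / m)) * Real.exp (-((j : ℝ) * (j - 1) / (2 * m)))) := by ring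
      _ = _ := by
          rw [← Real.exp_add]
          congr 2
          push_cast; field_simp; ring

/-- Odd `k` contributes nothing. For `k = 2j` the count is at most `(2m)!/(2^m m!)` times `2^j
m(m-1)⋯(m-j+1)`. The power `(2m)^j` cancels, and the Gaussian decay `exp(-j(j-1)/(2m))` absorbs
`exp(2jη)`. The bound does not depend on `k`, so summing over `k` costs only a factor `2m + 1`. -/
theorem choose_mul_involutionCount_le {m k : ℕ} (hm : 1 ≤ m) (hk : k ≤ 2 * m) {ρ η : ℝ}
    (hρ : 0 ≤ ρ) (hη : ρ ≤ Real.exp η) :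
    (((2 * m).choose k * k.factorial * involutionCount (2 * m - k) : ℕ) : ℝ) *
        (ρ / √(2 * m : ℝ)) ^ k ≤
      Real.exp 1 * m * (2 * m : ℝ) ^ m * Real.exp (-m) * Real.exp (2 * m * η ^ 2 + 1) := by
  have hm0 : (0 : ℝ) < m := by exact_mod_cast hm
  rw [involutionCount]
  split_ifs with he
  swap
  · simp only [mul_zero, Nat.cast_zero, zero_mul]; positivity
  obtain ⟨j, rfl⟩ : ∃ j, k = 2 * j := by
    rw [Nat.even_sub hk] at he
    obtain ⟨j, hj⟩ := he.1 (even_two_mul m)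
    exact ⟨j, by omega⟩
  have hj : j ≤ m := by omega
  have h1 : (((2 * m).choose (2 * j) * (2 * j).factorial *
      ((2 * m - 2 * j).factorial / (2 ^ ((2 * m - 2 * j) / 2) * ((2 * m - 2 * j) / 2).factorial) :
        ℕ) : ℕ) : ℝ) * (2 ^ m * m.factorial) ≤
      (2 * m).factorial * (2 ^ j * m.descFactorial j) := by
    have e1 : (2 * m - 2 * j) / 2 = m - j := by omega
    rw [e1]
    have e2 : 2 ^ m * m.factorial =
        (2 ^ (m - j) * (m - j).factorial) * (2 ^ j * m.descFactorial j) := by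
      rw [← Nat.factorial_mul_descFactorial hj, mul_mul_mul_comm, ← pow_add,
        Nat.sub_add_cancel hj]
    have e3 : (2 * m).choose (2 * j) * (2 * j).factorial *
        ((2 * m - 2 * j).factorial / (2 ^ (m - j) * (m - j).factorial)) *
        (2 ^ m * m.factorial) ≤ (2 * m).factorial * (2 ^ j * m.descFactorial j) := by
      rw [e2, ← Nat.choose_mul_factorial_mul_factorial hk]
      calc _ = (2 * m).choose (2 * j) * (2 * j).factorial *
            ((2 * m - 2 * j).factorial / (2 ^ (m - j) * (m - j).factorial) *
              (2 ^ (m - j) * (m - j).factorial)) * (2 ^ j * m.descFactorial j) := by ring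
        _ ≤ _ := Nat.mul_le_mul_right _ (Nat.mul_le_mul_left _ (Nat.div_mul_le_self _ _))
    exact_mod_cast e3
  have h2 : (ρ / √(2 * m : ℝ)) ^ (2 * j) ≤ Real.exp (2 * j * η) / (2 * m : ℝ) ^ j := by
    rw [div_pow, pow_mul (√(2 * m : ℝ)), Real.sq_sqrt (by positivity)]
    refine div_le_div_of_nonneg_right ?_ (by positivity)
    calc ρ ^ (2 * j) ≤ Real.exp η ^ (2 * j) := pow_le_pow_left₀ hρ hη _
      _ = _ := by rw [← Real.exp_nat_mul]; push_cast; rfl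
  have h3 := two_pow_mul_descFactorial_le hm hj
  have h4 := factorial_two_mul_le hm
  have hK : (0 : ℝ) < 2 ^ m * m.factorial := by positivity
  rw [← mul_le_mul_iff_left₀ hK]
  -- Completing the square at `j = 2mη`.
  have h5 : 2 * (j : ℝ) * η - (j : ℝ) * (j - 1) / (2 * m) ≤ 2 * m * η ^ 2 + 1 := by
    have hjm : (j : ℝ) ≤ m := by exact_mod_cast hj
    have : 2 * (m : ℝ) * η ^ 2 + 1 - (2 * (j : ℝ) * η - (j : ℝ) * (j - 1) / (2 * m)) =
        (2 * m * η - j) ^ 2 / (2 * m) + (2 * m - j) / (2 * m) := by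
      field_simp; ring
    have h6 : 0 ≤ (2 * m * η - j) ^ 2 / (2 * m) + (2 * m - j) / (2 * m) := by
      have : (0 : ℝ) ≤ 2 * m - j := by linarith
      positivity
    linarith
  have h4' : ((2 * m).factorial : ℝ) ≤
      (2 ^ m * m.factorial) * (Real.exp 1 * m * (2 * m : ℝ) ^ m) * Real.exp (-m) := by
    rw [Real.exp_neg, ← div_eq_mul_inv, le_div_iff₀ (Real.exp_pos _)]
    exact h4
  calc _ = ((((2 * m).choose (2 * j) * (2 * j).factorial *
      ((2 * m - 2 * j).factorial / (2 ^ ((2 * m - 2 * j) / 2) * ((2 * m - 2 * j) / 2).factorial) :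
        ℕ) : ℕ) : ℝ) * (2 ^ m * m.factorial)) * (ρ / √(2 * m : ℝ)) ^ (2 * j) := by ring
    _ ≤ ((2 * m).factorial * (2 ^ j * m.descFactorial j)) *
        (Real.exp (2 * j * η) / (2 * m : ℝ) ^ j) :=
        mul_le_mul h1 h2 (by positivity) (by positivity)
    _ ≤ (((2 ^ m * m.factorial) * (Real.exp 1 * m * (2 * m : ℝ) ^ m) * Real.exp (-m)) *
        ((2 * m : ℝ) ^ j * Real.exp (-((j : ℝ) * (j - 1) / (2 * m))))) *
        (Real.exp (2 * j * η) / (2 * m : ℝ) ^ j) := by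
        refine mul_le_mul_of_nonneg_right (mul_le_mul h4' h3 (by positivity) (by positivity))
          (by positivity)
    _ = (2 ^ m * m.factorial) * (Real.exp 1 * m * (2 * m : ℝ) ^ m) * Real.exp (-m) *
        Real.exp (2 * (j : ℝ) * η - (j : ℝ) * (j - 1) / (2 * m)) := by
        rw [sub_eq_add_neg (2 * (j : ℝ) * η), Real.exp_add]
        field_simp
    _ ≤ (2 ^ m * m.factorial) * (Real.exp 1 * m * (2 * m : ℝ) ^ m) * Real.exp (-m) *
        Real.exp (2 * m * η ^ 2 + 1) :=
        mul_le_mul_of_nonneg_left (Real.exp_le_exp.2 h5) (by positivity)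
    _ = _ := by ring

theorem sum_pow_longCard_le_exp {m : ℕ} (hm : 1 ≤ m) {ρ η : ℝ} (hρ : 0 ≤ ρ)
    (hη : ρ ≤ Real.exp η) :
    ∑ P ∈ Finset.univ.filter (fun P : Equiv.Perm (Fin (2 * m)) => ∀ i, P i ≠ i),
        (ρ / √(2 * m : ℝ)) ^ longCard P ≤
      (2 * m + 1) *
        (Real.exp 1 * m * (2 * m : ℝ) ^ m * Real.exp (-m) * Real.exp (2 * m * η ^ 2 + 1)) := by
  refine (sum_pow_longCard_le _ (by positivity)).trans ?_
  refine (Finset.sum_le_card_nsmul _ _ _ fun k hk =>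
    choose_mul_involutionCount_le hm (by rw [Finset.mem_range] at hk; omega) hρ hη).trans_eq ?_
  rw [Finset.card_range, nsmul_eq_mul]
  push_cast
  rfl

/-! ### The tilted first moment -/

instance (n : ℕ) : IsProbabilityMeasure
    (ProbabilityTheory.uniformOn (Set.univ : Set (Roommates n))) :=
  ProbabilityTheory.isProbabilityMeasure_uniformOn Set.finite_univ Set.univ_nonempty

open Classical in
theorem prob_eq (A : Set (Roommates n)) :
    prob n A = ((Finset.univ.filter fun I => I ∈ A).card : ℝ) / Fintype.card (Roommates n) := by
  have : MeasurableSingletonClass (Roommates n) := ⟨fun _ => trivial⟩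
  rw [prob, Measure.real, ProbabilityTheory.uniformOn_univ, Measure.count_apply_finite A A.toFinite,
    ENNReal.toReal_div]
  congr 1
  simp only [ENNReal.toReal_natCast, Nat.cast_inj]
  congr 1
  ext; simp

theorem prob_compl (A : Set (Roommates n)) : prob n Aᶜ = 1 - prob n A :=
  probReal_compl_eq_one_sub trivial

theorem prob_mono {A B : Set (Roommates n)} (h : A ⊆ B) : prob n A ≤ prob n B :=
  measureReal_mono h

theorem prob_union_le (A B : Set (Roommates n)) : prob n (A ∪ B) ≤ prob n A + prob n B :=
  measureReal_union_le A B

theorem prob_le_one (A : Set (Roommates n)) : prob n A ≤ 1 := measureReal_le_one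

/-- The expected sum of `z ^ (totalRank - n)` over the stable partitions without a fixed point. -/
noncomputable def stableMoment (n : ℕ) (z : ℝ) : ℝ :=
  open Classical in
  ∑ P ∈ Finset.univ.filter (fun P : Equiv.Perm (Fin n) => ∀ i, P i ≠ i),
    (∑ I ∈ Finset.univ.filter (fun I : Roommates n => I.IsStable P),
        z ^ ∑ i, (I.better i (P.symm i)).card) / Fintype.card (Roommates n)

/-- Markov's inequality: on the event, one term of the sum over `P` is already at least `1`. -/
theorem prob_exists_stable_le {z C : ℝ} (hz : 0 ≤ z) (hC : 0 ≤ C) :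
    prob n {I | ∃ P : Equiv.Perm (Fin n), I.IsStable P ∧ (∀ i, P i ≠ i) ∧
      1 ≤ C * z ^ ∑ i, (I.better i (P.symm i)).card} ≤ C * stableMoment n z := by
  classical
  rw [prob_eq, stableMoment, ← Finset.sum_div, ← mul_div_assoc]
  refine div_le_div_of_nonneg_right ?_ (by positivity)
  have hnn : ∀ (I : Roommates n) (P : Equiv.Perm (Fin n)),
      0 ≤ if I.IsStable P then C * z ^ ∑ i, (I.better i (P.symm i)).card else 0 := by
    intro I P; split_ifs <;> positivity
  simp_rw [Finset.sum_filter (fun I : Roommates n => I.IsStable _)]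
  rw [Finset.sum_comm, Finset.mul_sum, Finset.card_filter, Nat.cast_sum]
  refine Finset.sum_le_sum fun I _ => ?_
  simp_rw [Finset.mul_sum, mul_ite, mul_zero]
  split_ifs with h
  · obtain ⟨P, h1, h2, h3⟩ := h
    refine le_trans ?_ (Finset.single_le_sum (fun Q _ => hnn I Q)
      (show P ∈ _ by simpa using h2))
    rw [if_pos h1]
    simpa using h3
  · rw [Nat.cast_zero]
    exact Finset.sum_nonneg fun P _ => hnn I P

theorem exp_neg_add_sq_le {u : ℝ} (hu : |u| ≤ 1 / 2) : Real.exp (-(u + u ^ 2)) ≤ 1 - u := by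
  obtain ⟨h1, h2⟩ := abs_le.1 hu
  have h4 : 0 < 1 - u := by linarith
  rw [Real.exp_neg, inv_le_iff_one_le_mul₀ (Real.exp_pos _)]
  rcases le_total 0 u with h0 | h0
  · have h3 := Real.quadratic_le_exp_of_nonneg (by positivity : 0 ≤ u + u ^ 2)
    refine le_trans ?_ (mul_le_mul_of_nonneg_left h3 h4.le)
    have h5 : (1 - u) * (1 + (u + u ^ 2) + (u + u ^ 2) ^ 2 / 2) =
        1 + u ^ 2 * ((1 - 2 * u) + u * (1 - u * (1 + u))) / 2 := by ring
    have h6 : 0 ≤ 1 - u * (1 + u) := by nlinarith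
    have h7 : 0 ≤ u ^ 2 * ((1 - 2 * u) + u * (1 - u * (1 + u))) :=
      mul_nonneg (sq_nonneg u) (add_nonneg (by linarith) (mul_nonneg h0 h6))
    linarith
  · refine le_trans ?_ (mul_le_mul_of_nonneg_left (Real.add_one_le_exp (u + u ^ 2)) h4.le)
    have h5 : (1 - u) * (u + u ^ 2 + 1) = 1 + u ^ 2 * (-u) := by ring
    have h6 := mul_nonneg (sq_nonneg u) (neg_nonneg.2 h0)
    linarith

/-- Here `u` is the relative loss in the rate, `b = √n (1 - u)`. In the product of all bounds `e^m`
and `(2m)^m` cancel, which leaves `(1-u)^(-n)` and small corrections. -/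
theorem stableMoment_le_aux {m : ℕ} (hm : 1 ≤ m) {z u : ℝ} {lam : ℝ} (hz : z = Real.exp lam)
    (hz1 : |z - 1| ≤ 1 / 2) (hz2 : |z - 1| * √(2 * m : ℝ) ≤ 2) (hu : |u| ≤ 1 / 2)
    (hb : √(2 * m : ℝ) - (z - 1) * (2 * m) - 9 = √(2 * m : ℝ) * (1 - u)) :
    stableMoment (2 * m) z ≤ Real.exp ((z - 1) * (2 * m) + 2 * m * (u + u ^ 2) +
      2 * m * (|lam| + 2 * |u|) ^ 2 + 2) * ((2 * m + 1) * m) := by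
  classical
  have hm0 : (0 : ℝ) < m := by exact_mod_cast hm
  have hsq : 0 < √(2 * m : ℝ) := Real.sqrt_pos.2 (by positivity)
  have h1u : 0 < 1 - u := by linarith [(abs_le.1 hu).2]
  have hz0 : 0 < z := hz ▸ Real.exp_pos _
  have hexpu := exp_neg_add_sq_le hu
  have hinv : (1 - u)⁻¹ ≤ Real.exp (u + u ^ 2) := by
    rw [Real.exp_neg] at hexpu
    exact inv_le_of_inv_le₀ (Real.exp_pos _) hexpu
  have hρ : z / (1 - u) ≤ Real.exp (|lam| + 2 * |u|) := by
    rw [div_eq_mul_inv, hz]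
    refine (mul_le_mul_of_nonneg_left hinv (Real.exp_pos _).le).trans ?_
    rw [← Real.exp_add, Real.exp_le_exp]
    have := le_abs_self lam
    have := le_abs_self u
    have : u ^ 2 ≤ |u| := by
      rw [← sq_abs]; nlinarith [abs_nonneg u]
    linarith
  have hcast : ((2 * m : ℕ) : ℝ) = 2 * m := by push_cast; rfl
  have hbpos : 0 < √(2 * m : ℝ) * (1 - u) := mul_pos hsq h1u
  have hterm : ∀ P ∈ Finset.univ.filter
      (fun P : Equiv.Perm (Fin (2 * m)) => ∀ i, P i ≠ i),
      (∑ I ∈ Finset.univ.filter (fun I : Roommates (2 * m) => I.IsStable P),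
        z ^ ∑ i, (I.better i (P.symm i)).card) / Fintype.card (Roommates (2 * m)) ≤
      Real.exp (m + (z - 1) * (2 * m)) * (√(2 * m : ℝ) * (1 - u))⁻¹ ^ (2 * m) *
        (z / (1 - u) / √(2 * m : ℝ)) ^ longCard P := by
    intro P hP
    have hP : ∀ i, P i ≠ i := by simpa using hP
    refine (sum_stable_le_of_exponent hP hz0.le hbpos (a := m + (z - 1) * (2 * m))
      fun x hx hx' => ?_).trans_eq ?_
    · have := sum_pairExponent_le_linear (P := P) hz1 (by rw [hcast]; exact hz2) hx hx'
      rw [hcast, hb] at this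
      refine this.trans_eq ?_
      ring
    · rw [mul_assoc, div_div, mul_comm (1 - u)]
  rw [stableMoment]
  refine (Finset.sum_le_sum hterm).trans ?_
  rw [← Finset.mul_sum]
  refine (mul_le_mul_of_nonneg_left (sum_pow_longCard_le_exp hm (by positivity) hρ)
    (by positivity)).trans ?_
  have hpow : (√(2 * m : ℝ) * (1 - u))⁻¹ ^ (2 * m) ≤
      Real.exp (2 * m * (u + u ^ 2)) / (2 * m : ℝ) ^ m := by
    rw [mul_inv, mul_pow, inv_pow, pow_mul (√(2 * m : ℝ)), Real.sq_sqrt (by positivity), mul_comm,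
      div_eq_mul_inv]
    refine mul_le_mul_of_nonneg_right ?_ (by positivity)
    refine (pow_le_pow_left₀ (inv_pos.2 h1u).le hinv _).trans_eq ?_
    rw [← Real.exp_nat_mul, hcast]
  calc _ ≤ Real.exp (m + (z - 1) * (2 * m)) *
        (Real.exp (2 * m * (u + u ^ 2)) / (2 * m : ℝ) ^ m) * ((2 * m + 1) *
        (Real.exp 1 * m * (2 * m : ℝ) ^ m * Real.exp (-m) *
          Real.exp (2 * m * (|lam| + 2 * |u|) ^ 2 + 1))) :=
        mul_le_mul_of_nonneg_right (mul_le_mul_of_nonneg_left hpow (Real.exp_pos _).le)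
          (by positivity)
    _ = (Real.exp (m + (z - 1) * (2 * m)) * Real.exp (2 * m * (u + u ^ 2)) * Real.exp 1 *
        Real.exp (-m) * Real.exp (2 * m * (|lam| + 2 * |u|) ^ 2 + 1)) * ((2 * m + 1) * m) := by
        field_simp
    _ = _ := by
        simp_rw [← Real.exp_add]
        congr 2
        ring

/-- Since `z - 1 ≈ θ/√n`, the loss is `u ≈ θ + 9/√n`, and `n u` supplies the main term `θ n`. The
coefficient `58` is `8` from `n u²` plus `50` from the longer cycles. The condition `36 ≤ √n` keeps
`|u| ≤ 1/2`. -/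
theorem stableMoment_le {m : ℕ} {θ : ℝ} (hθ : |θ| ≤ 1 / 8) (hm : 36 ≤ √(2 * m : ℝ)) :
    stableMoment (2 * m) (Real.exp (θ / √(2 * m : ℝ))) ≤
      Real.exp (θ * (2 * m) + 58 * θ ^ 2 * (2 * m) + 900 * √(2 * m : ℝ)) := by
  set r := √(2 * m : ℝ) with hr
  have hr2 : r ^ 2 = 2 * m := Real.sq_sqrt (by positivity)
  have hr0 : 0 < r := by linarith
  have hm1 : 1 ≤ m := by
    rcases Nat.eq_zero_or_pos m with rfl | h
    · rw [hr] at hm; norm_num at hm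
    · exact h
  set lam := θ / r with hlam
  have hlr : lam * r = θ := by rw [hlam]; field_simp
  have hlabs : |lam| * r = |θ| := by rw [← hlr, abs_mul, abs_of_pos hr0]
  have hl1 : |lam| ≤ |θ| / 36 := by
    rw [le_div_iff₀ (by norm_num), ← hlabs]
    exact mul_le_mul_of_nonneg_left hm (abs_nonneg _)
  have hl2 : |lam| ≤ 1 := by linarith
  set h := Real.exp lam - 1 with hh
  have h1 : |h| ≤ 2 * |lam| := Real.abs_exp_sub_one_le hl2
  have h2 : h ≤ lam + lam ^ 2 := by
    have := (abs_le.1 (Real.abs_exp_sub_one_sub_id_le hl2)).2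
    linarith
  set u := h * r + 9 / r with hu
  have h9 : 9 / r ≤ 1 / 4 := by rw [div_le_iff₀ hr0]; linarith
  have h90 : 0 < 9 / r := by positivity
  have hhr : |h * r| ≤ 2 * |θ| := by
    rw [abs_mul, abs_of_pos hr0, ← hlabs]
    nlinarith
  have hu1 : |u| ≤ 2 * |θ| + 9 / r := by
    refine (abs_add_le _ _).trans ?_
    rw [abs_of_pos h90]; linarith
  have hu2 : |u| ≤ 1 / 2 := by linarith
  have h9r : 9 / r * r = 9 := by field_simp
  have key := stableMoment_le_aux hm1 (z := Real.exp lam) (u := u) (lam := lam) rfl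
    (by rw [← hh]; linarith) (by
      rw [← hh, ← hr]
      have : |h| * r = |h * r| := by rw [abs_mul, abs_of_pos hr0]
      linarith) hu2 (by
      rw [← hr, ← hh, ← hr2, hu]
      linear_combination h9r)
  refine key.trans ?_
  have hpoly : ((2 * m + 1) * m : ℝ) ≤ Real.exp (4 * r) := by
    have e1 : 1 + r ≤ Real.exp r := by linarith [Real.add_one_le_exp r]
    have e2 : Real.exp (4 * r) = (Real.exp r ^ 2) * (Real.exp r ^ 2) := by
      rw [← Real.exp_nat_mul, ← Real.exp_add]; congr 1; push_cast; ring
    have e3 : (1 + r) ^ 2 ≤ Real.exp r ^ 2 := pow_le_pow_left₀ (by linarith) e1 2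
    rw [e2]
    have hm0 : (0 : ℝ) ≤ m := Nat.cast_nonneg m
    refine mul_le_mul (le_trans ?_ e3) (le_trans ?_ e3) hm0 (by positivity) <;> nlinarith
  refine (mul_le_mul_of_nonneg_left hpoly (Real.exp_pos _).le).trans ?_
  rw [← Real.exp_add, Real.exp_le_exp, ← hr2, ← hh]
  have hθ0 := abs_nonneg θ
  have hθsq : θ ^ 2 = |θ| ^ 2 := (sq_abs θ).symm
  have t1 : h * r ^ 2 ≤ r := by
    have := le_abs_self (h * r)
    nlinarith
  have t2 : u * r ^ 2 ≤ θ * r ^ 2 + 10 * r := by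
    have e1 : u * r ^ 2 = h * r * r ^ 2 + 9 * r := by
      rw [hu]; field_simp
    have e2 : h * r * r ^ 2 ≤ (lam + lam ^ 2) * r * r ^ 2 := by gcongr
    have e3 : (lam + lam ^ 2) * r * r ^ 2 = θ * r ^ 2 + θ ^ 2 * r := by
      rw [← hlr]; ring
    have e4 : θ ^ 2 * r ≤ 1 * r := mul_le_mul_of_nonneg_right (by nlinarith) hr0.le
    linarith
  have t3 : r ^ 2 * u ^ 2 ≤ 8 * θ ^ 2 * r ^ 2 + 162 := by
    have e1 : |u| * r ≤ 2 * |θ| * r + 9 := by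
      calc _ ≤ (2 * |θ| + 9 / r) * r := mul_le_mul_of_nonneg_right hu1 hr0.le
        _ = _ := by rw [add_mul, h9r]
    have e2 : r ^ 2 * u ^ 2 = (|u| * r) ^ 2 := by rw [mul_pow, sq_abs]; ring
    have e3 := pow_le_pow_left₀ (mul_nonneg (abs_nonneg u) hr0.le) e1 2
    rw [e2, hθsq]
    linarith [sq_nonneg (2 * |θ| * r - 9)]
  have t4 : r ^ 2 * (|lam| + 2 * |u|) ^ 2 ≤ 50 * θ ^ 2 * r ^ 2 + 648 := by
    have e1 : (|lam| + 2 * |u|) * r ≤ 5 * |θ| * r + 18 := by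
      calc _ ≤ (5 * |θ| + 2 * (9 / r)) * r := mul_le_mul_of_nonneg_right (by linarith) hr0.le
        _ = _ := by linear_combination 2 * h9r
    have e2 : r ^ 2 * (|lam| + 2 * |u|) ^ 2 = ((|lam| + 2 * |u|) * r) ^ 2 := by ring
    have e3 := pow_le_pow_left₀ (by positivity) e1 2
    rw [e2, hθsq]
    linarith [sq_nonneg (5 * |θ| * r - 18)]
  linarith

/-! ### Concentration of the total rank -/

/-- The instances with a stable partition without a fixed point whose total rank deviates. -/
def deviation (n : ℕ) (ε : ℝ) : Set (Roommates n) :=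
  {I | ∃ P : Equiv.Perm (Fin n), I.IsStable P ∧ (∀ i, P i ≠ i) ∧
    ε ≤ |(I.totalRank P : ℝ) / (n : ℝ) ^ (3 / 2 : ℝ) - 1|}

theorem totalRank_eq (I : Roommates n) (P : Equiv.Perm (Fin n)) :
    I.totalRank P = (∑ i, (I.better i (P.symm i)).card) + n := by
  simp_rw [totalRank, rank_eq_card_better, Finset.sum_add_distrib]
  simp

theorem prob_deviation_le {m : ℕ} {ε : ℝ} (hε : 0 < ε) (hε1 : ε < 1)
    (hm : 36 ≤ √(2 * m : ℝ)) :
    prob (2 * m) (deviation (2 * m) ε) ≤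
      2 * Real.exp (-(ε ^ 2 / 232 * (2 * m)) + 901 * √(2 * m : ℝ)) := by
  set r := √(2 * m : ℝ) with hr
  have hr2 : r ^ 2 = 2 * m := Real.sq_sqrt (by positivity)
  have hr0 : 0 < r := by linarith
  have hcast : ((2 * m : ℕ) : ℝ) = r ^ 2 := by rw [hr2]; push_cast; rfl
  have h32 : ((2 * m : ℕ) : ℝ) ^ (3 / 2 : ℝ) = r ^ 3 := by
    rw [hcast, ← Real.rpow_natCast r 2, ← Real.rpow_mul hr0.le, ← Real.rpow_natCast r 3]
    norm_num
  -- This maximizes `t ε - 58 t²`, with value `ε²/232`.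
  set t := ε / 116 with ht
  have ht0 : 0 < t := by positivity
  have htε : t ≤ 1 / 8 := by rw [ht]; linarith
  let C : ℝ → ℝ := fun θ => Real.exp (-(θ * r ^ 2 + t * ε * r ^ 2 - r))
  let B : ℝ → Set (Roommates (2 * m)) := fun θ =>
    {I | ∃ P : Equiv.Perm (Fin (2 * m)), I.IsStable P ∧ (∀ i, P i ≠ i) ∧
      1 ≤ C θ * Real.exp (θ / r) ^ ∑ i, (I.better i (P.symm i)).card}
  have hB : ∀ θ, |θ| = t → prob (2 * m) (B θ) ≤
      Real.exp (-(ε ^ 2 / 232 * (2 * m)) + 901 * r) := by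
    intro θ hθ
    refine (prob_exists_stable_le (Real.exp_pos _).le (Real.exp_pos _).le).trans ?_
    refine (mul_le_mul_of_nonneg_left (stableMoment_le (by rw [hθ]; exact htε) hm)
      (Real.exp_pos _).le).trans ?_
    rw [← hr, ← hr2, ← Real.exp_add, Real.exp_le_exp, ← sq_abs θ, hθ, ht]
    apply le_of_eq
    ring
  have hmemB : ∀ (θ : ℝ) (I : Roommates (2 * m)) (P : Equiv.Perm (Fin (2 * m))),
      I.IsStable P → (∀ i, P i ≠ i) →
      θ * r ^ 2 + t * ε * r ^ 2 - r ≤ θ / r * ((I.totalRank P : ℝ) - r ^ 2) → I ∈ B θ := by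
    intro θ I P h1 h2 h3
    refine ⟨P, h1, h2, ?_⟩
    have h4 : ((∑ i, (I.better i (P.symm i)).card : ℕ) : ℝ) = I.totalRank P - r ^ 2 := by
      rw [totalRank_eq, Nat.cast_add, hcast]; ring
    rw [← Real.exp_nat_mul, h4, ← Real.exp_add, Real.one_le_exp_iff]
    linarith
  have hsub : deviation (2 * m) ε ⊆ B t ∪ B (-t) := by
    rintro I ⟨P, h1, h2, h3⟩
    rw [h32] at h3
    have hr3 : 0 < r ^ 3 := by positivity
    rcases le_abs.1 h3 with h | h
    · left
      have h4 : (1 + ε) * r ^ 3 ≤ I.totalRank P := by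
        rw [← le_div_iff₀ hr3]; linarith
      refine hmemB t I P h1 h2 ?_
      have h5 : t / r * ((1 + ε) * r ^ 3 - r ^ 2) ≤ t / r * ((I.totalRank P : ℝ) - r ^ 2) :=
        mul_le_mul_of_nonneg_left (by linarith) (by positivity)
      have h6 : t / r * ((1 + ε) * r ^ 3 - r ^ 2) = t * (1 + ε) * r ^ 2 - t * r := by
        field_simp
      nlinarith
    · right
      have h4 : (I.totalRank P : ℝ) ≤ (1 - ε) * r ^ 3 := by
        rw [← div_le_iff₀ hr3]; linarith
      refine hmemB (-t) I P h1 h2 ?_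
      have h5 : t / r * ((I.totalRank P : ℝ) - r ^ 2) ≤ t / r * ((1 - ε) * r ^ 3 - r ^ 2) :=
        mul_le_mul_of_nonneg_left (by linarith) (by positivity)
      have h6 : t / r * ((1 - ε) * r ^ 3 - r ^ 2) = t * (1 - ε) * r ^ 2 - t * r := by
        field_simp
      rw [neg_div, neg_mul]
      nlinarith
  refine (prob_mono hsub).trans ((prob_union_le _ _).trans ?_)
  have e1 := hB t (abs_of_pos ht0)
  have e2 := hB (-t) (by rw [abs_neg, abs_of_pos ht0])
  linarith

theorem eventually_prob_deviation_le {ε : ℝ} (hε : 0 < ε) (hε1 : ε < 1) :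
    ∃ N : ℕ, ∀ n : ℕ, N ≤ n → Even n →
      prob n (deviation n ε) ≤ Real.exp (-(1 * Real.log n ^ 2)) := by
  have hlog : ∀ᶠ x : ℝ in atTop, ‖Real.log x ^ 2‖ ≤ 1 / 4 * ‖id x‖ :=
    (Real.isLittleO_pow_log_id_atTop (n := 2)).def (by norm_num)
  -- With `x = √n`, the first condition says `log² n ≤ √n`. In `903`, one unit beyond `901` pays for
  -- `log² n` and one for the factor `2`.
  have hev : ∀ᶠ x : ℝ in atTop, Real.log x ^ 2 ≤ 1 / 4 * x ∧ 36 ≤ x ∧ 903 * 232 / ε ^ 2 ≤ x := by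
    filter_upwards [hlog, eventually_ge_atTop 36, eventually_ge_atTop (903 * 232 / ε ^ 2)]
      with x h1 h2 h3
    refine ⟨?_, h2, h3⟩
    rwa [Real.norm_of_nonneg (sq_nonneg _), id, Real.norm_of_nonneg (by linarith)] at h1
  have hsqrt : Tendsto (fun n : ℕ => √(n : ℝ)) atTop atTop :=
    Real.tendsto_sqrt_atTop.comp tendsto_natCast_atTop_atTop
  obtain ⟨N, hN⟩ := eventually_atTop.1 (hsqrt.eventually hev)
  refine ⟨N, fun n hn he => ?_⟩
  obtain ⟨h1, h2, h3⟩ := hN n hn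
  obtain ⟨m, rfl⟩ := he.two_dvd
  have hcast : ((2 * m : ℕ) : ℝ) = 2 * m := by push_cast; rfl
  rw [hcast] at h1 h2 h3 ⊢
  refine (prob_deviation_le hε hε1 h2).trans ?_
  set r := √(2 * m : ℝ) with hr
  have hr2 : r ^ 2 = 2 * m := Real.sq_sqrt (by positivity)
  have hr0 : 0 < r := by linarith
  rw [← hr2, Real.log_pow]
  have h4 : (2 : ℝ) ≤ Real.exp r := by linarith [Real.add_one_le_exp r]
  refine (mul_le_mul_of_nonneg_right h4 (Real.exp_pos _).le).trans ?_
  rw [← Real.exp_add, Real.exp_le_exp]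
  rw [div_le_iff₀ (by positivity)] at h3
  have h5 := mul_le_mul_of_nonneg_right h3 hr0.le
  push_cast
  nlinarith

/-! ### The worst rank -/

theorem rank_le_worstRank (I : Roommates n) (P : Equiv.Perm (Fin n)) (i : Fin n) :
    I.rank i (P.symm i) ≤ I.worstRank P :=
  Finset.le_sup (f := fun i => I.rank i (P.symm i)) (Finset.mem_univ i)

theorem totalRank_le (I : Roommates n) (P : Equiv.Perm (Fin n)) :
    I.totalRank P ≤ n * I.worstRank P := by
  refine (Finset.sum_le_card_nsmul _ _ _ fun i _ => rank_le_worstRank I P i).trans_eq ?_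
  simp

/-- The instances in which every stable partition has worst rank at least `(1 - ε) n^{1/2}`. -/
def largeWorstRank (n : ℕ) (ε : ℝ) : Set (Roommates n) :=
  {I | ∀ P : Equiv.Perm (Fin n), I.IsStable P →
    (1 - ε) * (n : ℝ) ^ (1 / 2 : ℝ) ≤ (I.worstRank P : ℝ)}

theorem compl_deviation_subset {ε : ℝ} (hn : 1 ≤ n) (hε : 0 < ε) (hε1 : ε < 1) :
    (deviation n ε)ᶜ ⊆ largeWorstRank n ε := by
  intro I hI P hP
  have hn1 : (1 : ℝ) ≤ n := by exact_mod_cast hn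
  have hn0 : (0 : ℝ) < n := by linarith
  by_cases hfix : ∀ i, P i ≠ i
  · have h1 : |(I.totalRank P : ℝ) / (n : ℝ) ^ (3 / 2 : ℝ) - 1| < ε := by
      by_contra h
      exact hI ⟨P, hP, hfix, not_lt.1 h⟩
    have h2 := (abs_lt.1 h1).1
    have h3 : (1 - ε) * (n : ℝ) ^ (3 / 2 : ℝ) ≤ I.totalRank P := by
      rw [← le_div_iff₀ (by positivity)]; linarith
    have h4 : (I.totalRank P : ℝ) ≤ n * I.worstRank P := by exact_mod_cast totalRank_le I P
    have h5 : (n : ℝ) ^ (3 / 2 : ℝ) = n * (n : ℝ) ^ (1 / 2 : ℝ) := by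
      rw [← Real.rpow_one_add' hn0.le (by norm_num)]; norm_num
    rw [h5] at h3
    have h6 : n * ((1 - ε) * (n : ℝ) ^ (1 / 2 : ℝ)) ≤ n * I.worstRank P := by linarith
    exact le_of_mul_le_mul_left h6 hn0
  -- A fixed point is its own predecessor, of rank `n ≥ √n`.
  · push Not at hfix
    obtain ⟨i, hi⟩ := hfix
    have h1 : P.symm i = i := by rw [Equiv.symm_apply_eq, hi]
    have h2 := rank_le_worstRank I P i
    rw [h1, rank_self] at h2
    have h3 : (n : ℝ) ≤ I.worstRank P := by exact_mod_cast h2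
    have h4 : (n : ℝ) ^ (1 / 2 : ℝ) ≤ (n : ℝ) ^ (1 : ℝ) :=
      Real.rpow_le_rpow_of_exponent_le hn1 (by norm_num)
    rw [Real.rpow_one] at h4
    have h5 : 0 ≤ (n : ℝ) ^ (1 / 2 : ℝ) := by positivity
    nlinarith

theorem eventually_le_prob_largeWorstRank {ε : ℝ} (hε : 0 < ε) (hε1 : ε < 1) :
    ∃ N : ℕ, ∀ n : ℕ, N ≤ n → Even n →
      1 - Real.exp (-(1 * Real.log n ^ 2)) ≤ prob n (largeWorstRank n ε) := by
  obtain ⟨N, hN⟩ := eventually_prob_deviation_le hε hε1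
  refine ⟨max N 1, fun n hn he => ?_⟩
  have h1 := hN n ((le_max_left _ _).trans hn) he
  have h2 := prob_mono (compl_deviation_subset ((le_max_right _ _).trans hn) hε hε1)
  rw [prob_compl] at h2
  linarith

theorem exists_tendsto_diagonal {Q : ℕ → ℕ → Prop} (h : ∀ k, ∀ᶠ n in atTop, Q k n) :
    ∃ κ : ℕ → ℕ, Tendsto κ atTop atTop ∧ ∀ᶠ n in atTop, Q (κ n) n := by
  classical
  choose N hN using fun k => eventually_atTop.1 (h k)
  -- The largest `k ≤ n` whose threshold has been passed. Once `n ≥ N 0` some such `k` exists, so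
  -- the default value `0` is harmless.
  refine ⟨fun n => Nat.findGreatest (fun k => N k ≤ n) n, ?_, ?_⟩
  · rw [tendsto_atTop]
    intro b
    filter_upwards [eventually_ge_atTop b, eventually_ge_atTop (N b)] with n h1 h2
    exact Nat.le_findGreatest h1 h2
  · filter_upwards [eventually_ge_atTop (N 0)] with n hn
    exact hN _ _ (Nat.findGreatest_spec (P := fun k => N k ≤ n) (Nat.zero_le n) hn)

end Roommates

theorem mainTheorem4 :
    -- concentration of the total rank, over all stable partitions without a fixed point
    (∀ ε : ℝ, 0 < ε → ε < 1 →
      ∃ c : ℝ, 0 < c ∧ ∃ N : ℕ, ∀ n : ℕ, N ≤ n → Even n →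
        Roommates.prob n {I | ∃ P : Equiv.Perm (Fin n), I.IsStable P ∧ (∀ i, P i ≠ i) ∧
            ε ≤ |(I.totalRank P : ℝ) / (n : ℝ) ^ (3 / 2 : ℝ) - 1|}
          ≤ Real.exp (-(c * Real.log n ^ 2))) ∧
    -- the worst rank in every stable partition, for a fixed ε
    (∀ ε : ℝ, 0 < ε → ε < 1 →
      ∃ c : ℝ, 0 < c ∧ ∃ N : ℕ, ∀ n : ℕ, N ≤ n → Even n →
        1 - Real.exp (-(c * Real.log n ^ 2)) ≤
          Roommates.prob n {I | ∀ P : Equiv.Perm (Fin n), I.IsStable P →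
            (1 - ε) * (n : ℝ) ^ (1 / 2 : ℝ) ≤ (I.worstRank P : ℝ)}) ∧
    -- the same with 1 - o(1) in place of 1 - ε, with high probability
    (∃ δ : ℕ → ℝ, Tendsto δ atTop (𝓝 0) ∧
      Tendsto
        (fun m : ℕ => Roommates.prob (2 * m) {I | ∀ P : Equiv.Perm (Fin (2 * m)), I.IsStable P →
          (1 - δ (2 * m)) * ((2 * m : ℕ) : ℝ) ^ (1 / 2 : ℝ) ≤ (I.worstRank P : ℝ)})
        atTop (𝓝 1)) := by
  refine ⟨fun ε h0 h1 => ⟨1, one_pos, Roommates.eventually_prob_deviation_le h0 h1⟩,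
    fun ε h0 h1 => ⟨1, one_pos, Roommates.eventually_le_prob_largeWorstRank h0 h1⟩, ?_⟩
  have hQ : ∀ k : ℕ, ∀ᶠ n : ℕ in atTop, Even n → 1 - Real.exp (-(1 * Real.log n ^ 2)) ≤
      Roommates.prob n (Roommates.largeWorstRank n (1 / ((k : ℝ) + 1 + 1))) := by
    intro k
    obtain ⟨N, hN⟩ := Roommates.eventually_le_prob_largeWorstRank
      (ε := 1 / ((k : ℝ) + 1 + 1)) (by positivity)
      (by rw [div_lt_one (by positivity)]; linarith [Nat.cast_nonneg (α := ℝ) k])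
    exact (eventually_ge_atTop N).mono hN
  obtain ⟨κ, hκ, hev⟩ := Roommates.exists_tendsto_diagonal hQ
  have hdouble : Tendsto (fun m : ℕ => 2 * m) atTop atTop :=
    tendsto_id.const_mul_atTop' two_pos
  -- The shift by two keeps the value below `1` even when `κ n = 0`.
  refine ⟨fun n => 1 / ((κ n : ℝ) + 1 + 1), ?_, ?_⟩
  · have h1 : Tendsto (fun n => (κ n : ℝ) + 1 + 1) atTop atTop :=
      tendsto_atTop_add_const_right _ _ (tendsto_atTop_add_const_right _ _
        (tendsto_natCast_atTop_atTop.comp hκ))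
    simp only [one_div]
    exact tendsto_inv_atTop_zero.comp h1
  · have hlog : Tendsto (fun n : ℕ => 1 * Real.log n ^ 2) atTop atTop := by
      simp only [one_mul]
      exact (tendsto_pow_atTop two_ne_zero).comp
        (Real.tendsto_log_atTop.comp tendsto_natCast_atTop_atTop)
    have hlow : Tendsto (fun m : ℕ => 1 - Real.exp (-(1 * Real.log (2 * m : ℕ) ^ 2)))
        atTop (𝓝 1) := by
      have := (Real.tendsto_exp_neg_atTop_nhds_zero.comp (hlog.comp hdouble)).const_sub 1
      rw [sub_zero] at this
      exact this
    refine tendsto_of_tendsto_of_tendsto_of_le_of_le' hlow tendsto_const_nhds ?_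
      (Eventually.of_forall fun m => Roommates.prob_le_one _)
    filter_upwards [hdouble.eventually hev] with m hm
    exact hm (even_two_mul m)
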